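/- Let $\Bbbk$ be a field and $H$ a bialgebra over $\Bbbk$, with comultiplication $\Delta(h)=h_{(1)}\otimes h_{(2)}$ and counit $\varepsilon$. A left $H$-module coalgebra is a coalgebra $D$ with a left $H$-module structure such that $\Delta(hd)=h_{(1)}d_{(1)}\otimes h_{(2)}d_{(2)}$ and $\varepsilon(hd)=\varepsilon(h)\varepsilon(d)$. For such $D$, let $\mathfrak{M}^D$ be the category of right $D$-comodules, and let ${}^H_H\mathfrak{M}^D$ be the category of left $H$-modules $M$ equipped with an $H$-$D$-bicomodule structure, with left $H$-coaction $\delta^{\ell}(m)=m_{(-1)}\otimes m_{(0)}$ and right $D$-coaction $\delta^{r}(m)=m_{(0)}\otimes m_{(1)}$, such that $$\delta^{\ell}(hm)=h_{(1)}m_{(-1)}\otimes h_{(2)}m_{(0)},\qquad \delta^{r}(hm)=h_{(1)}m_{(0)}\otimes h_{(2)}m_{(1)}\qquad(h\in H,\ m\in M);$$ its morphisms are the linear maps that are left $H$-linear, left $H$-colinear and right $D$-colinear. The category ${}^H_H\mathfrak{M}$ is defined in the same way without $D$ and $\delta^r$. Let $$\Psi_D:\mathfrak{M}^D\to{}^H_H\mathfrak{M}^D,\qquad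 \Psi_D(W)=H\otimes W,\quad f\mapsto \mathrm{id}_H\otimes f,$$ where $H\otimes W$ has the left $H$-action $h\cdot(h'\otimes w)=hh'\otimes w$, the left $H$-coaction $\Delta\otimes\mathrm{id}_W$ and the right $D$-coaction $h\otimes w\mapsto h_{(1)}\otimes w_{(0)}\otimes h_{(2)}w_{(1)}$. Let $\Psi_{\Bbbk}:\mathbf{Vec}\to{}^H_H\mathfrak{M}$, $W\mapsto H\otimes W$, with the same left action and left coaction (the case $D=\Bbbk$, where $\mathfrak{M}^{\Bbbk}=\mathbf{Vec}$ and ${}^H_H\mathfrak{M}^{\Bbbk}={}^H_H\mathfrak{M}$). Theorem. The following are equivalent: 1. $H$ is a Hopf algebra, that is, it has an antipode. 2. $\Psi_D$ is an equivalence of categories for all left $H$-module coalgebras $D$. 3. $\Psi_{\Bbbk}:\mathbf{Vec}\to{}^H_H\mathfrak{M}$ is an equivalence. 4. $\Psi_H:\mathfrak{M}^H\to{}^H_H\mathfrak{M}^H$ is an equivalence. If these equivalent conditions are satisfied, then for every left $H$-module coalgebra $D$ a quasi-inverse of $\Psi_D$ is given by the functor of left $H$-coinvariants $$M\mapsto\{m\in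 M\mid \delta^{\ell}(m)=1\otimes m\}\qquad(M\in{}^H_H\mathfrak{M}^D),$$ which is a right $D$-comodule as a $D$-subcomodule of $M$. Likewise, a quasi-inverse of $\Psi_{\Bbbk}:\mathbf{Vec}\to{}^H_H\mathfrak{M}$ is given by $M\mapsto\{m\in M\mid \delta^{\ell}(m)=1\otimes m\}$. -/

import Mathlib

open CategoryTheory TensorProduct

universe v u

namespace HopfMod

section Basic

variable (k : Type v) [Field k] (H : Type u) [Ring H] [Bialgebra k H]

/-- The bialgebra `H` is a Hopf algebra: it has an antipode, that is, a linear map `S : H → H`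
with `S(h₁) h₂ = ε(h) 1 = h₁ S(h₂)`. -/
def HasAntipode : Prop :=
  ∃ S : H →ₗ[k] H,
    LinearMap.mul' k H ∘ₗ S.rTensor H ∘ₗ Coalgebra.comul =
      Algebra.linearMap k H ∘ₗ Coalgebra.counit ∧
    LinearMap.mul' k H ∘ₗ S.lTensor H ∘ₗ Coalgebra.comul =
      Algebra.linearMap k H ∘ₗ Coalgebra.counit

/-- The left `H`-action on `M` as a bilinear map `h ↦ m ↦ h • m`. -/
def act (M : Type u) [AddCommGroup M] [Module k M] [Module H M] [IsScalarTower k H M] :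
    H →ₗ[k] M →ₗ[k] M :=
  (Algebra.lsmul k k M).toLinearMap

@[simp]
theorem act_apply (M : Type u) [AddCommGroup M] [Module k M] [Module H M] [IsScalarTower k H M]
    (h : H) (m : M) : act k H M h m = h • m := rfl

/-- The factorwise action of `H ⊗ H` on `M ⊗ N`, `(a ⊗ b) · (m ⊗ n) = a m ⊗ b n`.
The diagonal action of `h : H` on `M ⊗ N` is `act₂ k H M N (Δ h)`. -/
def act₂ (M N : Type u) [AddCommGroup M] [Module k M] [Module H M] [IsScalarTower k H M]
    [AddCommGroup N] [Module k N] [Module H N] [IsScalarTower k H N] :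
    H ⊗[k] H →ₗ[k] M ⊗[k] N →ₗ[k] M ⊗[k] N :=
  TensorProduct.map₂ (act k H M) (act k H N)

@[simp]
theorem act₂_tmul (M N : Type u) [AddCommGroup M] [Module k M] [Module H M] [IsScalarTower k H M]
    [AddCommGroup N] [Module k N] [Module H N] [IsScalarTower k H N] (a b : H) (m : M) (n : N) :
    act₂ k H M N (a ⊗ₜ b) (m ⊗ₜ n) = (a • m) ⊗ₜ (b • n) := rfl

/-- A left `H`-module coalgebra `D`: a coalgebra and left `H`-module whose comultiplication and
counit are `H`-linear, `Δ(h d) = h₁ d₁ ⊗ h₂ d₂` and `ε(h d) = ε(h) ε(d)`. -/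
class ModuleCoalgebra (D : Type u) [AddCommGroup D] [Module k D] [Coalgebra k D] [Module H D]
    [IsScalarTower k H D] : Prop where
  comul_smul : ∀ (h : H) (d : D),
    Coalgebra.comul (R := k) (h • d) = act₂ k H D D (Coalgebra.comul h) (Coalgebra.comul d)
  counit_smul : ∀ (h : H) (d : D),
    Coalgebra.counit (R := k) (h • d) = Coalgebra.counit (R := k) h * Coalgebra.counit (R := k) d

/-- `H` is a left module coalgebra over itself by multiplication. -/
instance : ModuleCoalgebra k H H where
  comul_smul h d := by
    rw [smul_eq_mul, Bialgebra.comul_mul]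
    generalize (Coalgebra.comul h : H ⊗[k] H) = s
    generalize (Coalgebra.comul d : H ⊗[k] H) = t
    induction s with
    | zero => simp
    | add x y hx hy => simp [add_mul, hx, hy]
    | tmul a b =>
      induction t with
      | zero => simp
      | add x y hx hy => simp [mul_add, hx, hy]
      | tmul c d => simp
  counit_smul h d := by simp

end Basic

section RightComodule

variable (k : Type v) [Field k] (D : Type u) [AddCommGroup D] [Module k D] [Coalgebra k D]

/-- Right `D`-comodules. -/
structure RightComod where
  carrier : Type u
  [addCommGroup : AddCommGroup carrier]
  [module : Module k carrier]
  /-- the coaction `w ↦ w₀ ⊗ w₁` -/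
  coact : carrier →ₗ[k] carrier ⊗[k] D
  coassoc : (TensorProduct.assoc k carrier D D).toLinearMap ∘ₗ coact.rTensor D ∘ₗ coact =
    Coalgebra.comul.lTensor carrier ∘ₗ coact
  counit_coact : Coalgebra.counit.lTensor carrier ∘ₗ coact =
    (TensorProduct.mk k carrier k).flip 1

attribute [instance] RightComod.addCommGroup RightComod.module

variable {k D}

/-- Right `D`-colinear maps. -/
@[ext]
structure RightComod.Hom (V W : RightComod k D) where
  toLinearMap : V.carrier →ₗ[k] W.carrier
  colinear : W.coact ∘ₗ toLinearMap = toLinearMap.rTensor D ∘ₗ V.coact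

/-- The category of right `D`-comodules. -/
instance : Category (RightComod k D) where
  Hom V W := RightComod.Hom V W
  id V := ⟨LinearMap.id, by simp⟩
  comp f g := ⟨g.toLinearMap ∘ₗ f.toLinearMap, by
    rw [← LinearMap.comp_assoc, g.colinear, LinearMap.comp_assoc, f.colinear,
      LinearMap.rTensor_comp, LinearMap.comp_assoc]⟩

end RightComodule

section LeftHopfModule

variable (k : Type v) [Field k] (H : Type u) [Ring H] [Bialgebra k H]

/-- Left Hopf modules over `H`: left `H`-modules with a left `H`-comodule structure such that
the coaction is `H`-linear for the diagonal action on `H ⊗ M`. -/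
structure LeftHopfMod where
  carrier : Type u
  [addCommGroup : AddCommGroup carrier]
  [module : Module k carrier]
  [moduleH : Module H carrier]
  [isScalarTower : IsScalarTower k H carrier]
  /-- the coaction `m ↦ m₋₁ ⊗ m₀` -/
  lcoact : carrier →ₗ[k] H ⊗[k] carrier
  lcoassoc : (TensorProduct.assoc k H H carrier).toLinearMap ∘ₗ
    Coalgebra.comul.rTensor carrier ∘ₗ lcoact = lcoact.lTensor H ∘ₗ lcoact
  counit_lcoact : Coalgebra.counit.rTensor carrier ∘ₗ lcoact = TensorProduct.mk k k carrier 1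
  /-- `λ(h m) = h₁ m₋₁ ⊗ h₂ m₀` -/
  lcoact_smul : ∀ (h : H) (m : carrier),
    lcoact (h • m) = act₂ k H H carrier (Coalgebra.comul h) (lcoact m)

attribute [instance] LeftHopfMod.addCommGroup LeftHopfMod.module LeftHopfMod.moduleH
  LeftHopfMod.isScalarTower

variable {k H}

/-- Maps which are left `H`-linear and left `H`-colinear. -/
@[ext]
structure LeftHopfMod.Hom (M N : LeftHopfMod k H) where
  toLinearMap : M.carrier →ₗ[k] N.carrier
  map_smul : ∀ (h : H) (m : M.carrier), toLinearMap (h • m) = h • toLinearMap m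
  lcolinear : N.lcoact ∘ₗ toLinearMap = toLinearMap.lTensor H ∘ₗ M.lcoact

/-- The category of left Hopf modules over `H`. -/
instance : Category (LeftHopfMod k H) where
  Hom M N := LeftHopfMod.Hom M N
  id M := ⟨LinearMap.id, fun _ _ => rfl, by simp⟩
  comp f g := ⟨g.toLinearMap ∘ₗ f.toLinearMap,
    fun h m => by simp [f.map_smul, g.map_smul], by
    rw [← LinearMap.comp_assoc, g.lcolinear, LinearMap.comp_assoc, f.lcolinear,
      LinearMap.lTensor_comp, LinearMap.comp_assoc]⟩

variable (k H)

/-- The left Hopf module `H ⊗ V` with action `h · (h' ⊗ v) = h h' ⊗ v` (Mathlib's module structure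
on `H ⊗ V`) and coaction `h ⊗ v ↦ h₁ ⊗ h₂ ⊗ v`. -/
def free (V : Type u) [AddCommGroup V] [Module k V] : LeftHopfMod k H where
  carrier := H ⊗[k] V
  lcoact := (TensorProduct.assoc k H H V).toLinearMap ∘ₗ Coalgebra.comul.rTensor V
  lcoassoc := by
    ext h v
    have key : ∀ t : H ⊗[k] H,
        (TensorProduct.assoc k H H (H ⊗[k] V)) ((Coalgebra.comul.rTensor (H ⊗[k] V))
          ((TensorProduct.assoc k H H V) (t ⊗ₜ v))) =
        (TensorProduct.assoc k H H V).toLinearMap.lTensor H ((TensorProduct.assoc k H (H ⊗[k] H) V)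
          (((TensorProduct.assoc k H H H) (Coalgebra.comul.rTensor H t)) ⊗ₜ v)) := by
      intro t
      induction t with
      | zero => simp
      | add x y hx hy => simp only [map_add, add_tmul, hx, hy]
      | tmul a b =>
        simp only [TensorProduct.assoc_tmul, LinearMap.rTensor_tmul]
        generalize (Coalgebra.comul a : H ⊗[k] H) = s
        induction s with
        | zero => simp
        | add x y hx hy => simp only [map_add, add_tmul, hx, hy]
        | tmul c d => simp
    have key2 : ∀ t : H ⊗[k] H,
        ((TensorProduct.assoc k H H V).toLinearMap ∘ₗ Coalgebra.comul.rTensor V).lTensor H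
          ((TensorProduct.assoc k H H V) (t ⊗ₜ v)) =
        (TensorProduct.assoc k H H V).toLinearMap.lTensor H ((TensorProduct.assoc k H (H ⊗[k] H) V)
          ((Coalgebra.comul.lTensor H t) ⊗ₜ v)) := by
      intro t
      induction t with
      | zero => simp
      | add x y hx hy => simp only [map_add, add_tmul, hx, hy]
      | tmul a b => simp
    have h1 := key (Coalgebra.comul h)
    have h2 := key2 (Coalgebra.comul h)
    rw [Coalgebra.coassoc_apply] at h1
    simpa using h1.trans h2.symm
  counit_lcoact := by
    ext h v
    have key : ∀ t : H ⊗[k] H,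
        Coalgebra.counit.rTensor (H ⊗[k] V) ((TensorProduct.assoc k H H V) (t ⊗ₜ v)) =
        (TensorProduct.assoc k k H V) ((Coalgebra.counit.rTensor H t) ⊗ₜ v) := by
      intro t
      induction t with
      | zero => simp
      | add x y hx hy => simp only [map_add, add_tmul, hx, hy]
      | tmul a b => simp
    simpa using key (Coalgebra.comul h)
  lcoact_smul h m := by
    induction m with
    | zero => simp
    | add x y hx hy => simp only [smul_add, map_add, hx, hy]
    | tmul a v =>
      simp only [TensorProduct.smul_tmul', smul_eq_mul, LinearMap.coe_comp, Function.comp_apply,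
        LinearMap.rTensor_tmul, Bialgebra.comul_mul, LinearEquiv.coe_coe]
      generalize (Coalgebra.comul h : H ⊗[k] H) = s
      generalize (Coalgebra.comul a : H ⊗[k] H) = t
      induction s with
      | zero => simp
      | add x y hx hy => simp only [add_mul, add_tmul, map_add, LinearMap.add_apply, hx, hy]
      | tmul c d =>
        induction t with
        | zero => simp
        | add x y hx hy => simp only [mul_add, add_tmul, map_add, hx, hy]
        | tmul e f => simp [TensorProduct.smul_tmul']

/-- The functor `V ↦ H ⊗ V` from vector spaces to left Hopf modules over `H`. -/
def psiVec : ModuleCat.{u} k ⥤ LeftHopfMod k H where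
  obj V := free k H V
  map f :=
    { toLinearMap := f.hom.lTensor H
      map_smul := fun h m => (f.hom.baseChange H).map_smul h m
      lcolinear := by
        change ((TensorProduct.assoc k H H _).toLinearMap ∘ₗ Coalgebra.comul.rTensor _) ∘ₗ
          f.hom.lTensor H = (f.hom.lTensor H).lTensor H ∘ₗ
            ((TensorProduct.assoc k H H _).toLinearMap ∘ₗ Coalgebra.comul.rTensor _)
        ext h v
        simp only [AlgebraTensorModule.curry_apply, curry_apply, LinearMap.coe_restrictScalars,
          LinearMap.coe_comp, Function.comp_apply, LinearMap.lTensor_tmul, LinearMap.rTensor_tmul,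
          LinearEquiv.coe_coe]
        generalize (Coalgebra.comul h : H ⊗[k] H) = s
        induction s with
        | zero => simp
        | add x y hx hy => simp only [add_tmul, map_add, hx, hy]
        | tmul c d => simp }
  map_id V := by
    apply LeftHopfMod.Hom.ext
    exact LinearMap.lTensor_id H V
  map_comp f g := by
    apply LeftHopfMod.Hom.ext
    exact LinearMap.lTensor_comp H g.hom f.hom

variable {k H}

/-- The space of left `H`-coinvariants `{m ∈ M | λ(m) = 1 ⊗ m}`. -/
def LeftHopfMod.coinv (M : LeftHopfMod k H) : Submodule k M.carrier :=
  LinearMap.ker (M.lcoact - TensorProduct.mk k H M.carrier 1)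

theorem LeftHopfMod.mem_coinv (M : LeftHopfMod k H) (m : M.carrier) :
    m ∈ M.coinv ↔ M.lcoact m = 1 ⊗ₜ m := by
  simp [LeftHopfMod.coinv, sub_eq_zero]

/-- Morphisms of left Hopf modules preserve coinvariants. -/
theorem LeftHopfMod.Hom.map_coinv {M N : LeftHopfMod k H} (f : LeftHopfMod.Hom M N)
    (m : M.carrier) (hm : m ∈ M.coinv) : f.toLinearMap m ∈ N.coinv := by
  rw [LeftHopfMod.mem_coinv] at hm ⊢
  have := LinearMap.congr_fun f.lcolinear m
  simpa [hm] using this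

/-- The restriction of a morphism of left Hopf modules to the coinvariants. -/
def LeftHopfMod.Hom.restrict {M N : LeftHopfMod k H} (f : LeftHopfMod.Hom M N) :
    M.coinv →ₗ[k] N.coinv :=
  f.toLinearMap.restrict f.map_coinv

variable (k H)

/-- The functor of left `H`-coinvariants from left Hopf modules to vector spaces. -/
def coinvVec : LeftHopfMod k H ⥤ ModuleCat.{u} k where
  obj M := ModuleCat.of k M.coinv
  map f := ModuleCat.ofHom (LeftHopfMod.Hom.restrict f)
  map_id _ := rfl
  map_comp _ _ := rfl

end LeftHopfModule

section Mix

variable {k : Type v} [Field k] {H : Type u} [Ring H] [Bialgebra k H]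
  {D : Type u} [AddCommGroup D] [Module k D] [Module H D] [IsScalarTower k H D]

/-- The bilinear map `(a ⊗ b, w ⊗ d) ↦ (a ⊗ w) ⊗ b d`. -/
def mix (W : Type u) [AddCommGroup W] [Module k W] :
    H ⊗[k] H →ₗ[k] W ⊗[k] D →ₗ[k] (H ⊗[k] W) ⊗[k] D :=
  TensorProduct.map₂ (TensorProduct.mk k H W) (act k H D)

@[simp]
theorem mix_tmul (W : Type u) [AddCommGroup W] [Module k W] (a b : H) (w : W) (d : D) :
    mix (k := k) W (a ⊗ₜ b) (w ⊗ₜ d) = (a ⊗ₜ w) ⊗ₜ (b • d) := rfl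

end Mix

section HopfModule

variable (k : Type v) [Field k] (H : Type u) [Ring H] [Bialgebra k H]
  (D : Type u) [AddCommGroup D] [Module k D] [Coalgebra k D] [Module H D] [IsScalarTower k H D]

/-- The objects of `ᴴ_H𝔐ᴰ`: left `H`-modules `M` with an `H`-`D`-bicomodule structure such that
both coactions are `H`-linear for the diagonal actions on `H ⊗ M` and `M ⊗ D`. -/
structure RelHopfMod extends LeftHopfMod k H where
  /-- the coaction `m ↦ m₀ ⊗ m₁` -/
  rcoact : carrier →ₗ[k] carrier ⊗[k] D
  rcoassoc : (TensorProduct.assoc k carrier D D).toLinearMap ∘ₗ rcoact.rTensor D ∘ₗ rcoact =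
    Coalgebra.comul.lTensor carrier ∘ₗ rcoact
  counit_rcoact : Coalgebra.counit.lTensor carrier ∘ₗ rcoact =
    (TensorProduct.mk k carrier k).flip 1
  /-- the left and the right coaction commute -/
  bicomodule : (TensorProduct.assoc k H carrier D).toLinearMap ∘ₗ lcoact.rTensor D ∘ₗ rcoact =
    rcoact.lTensor H ∘ₗ lcoact
  /-- `ρ(h m) = h₁ m₀ ⊗ h₂ m₁` -/
  rcoact_smul : ∀ (h : H) (m : carrier),
    rcoact (h • m) = act₂ k H carrier D (Coalgebra.comul h) (rcoact m)

variable {k H D}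

/-- Maps which are left `H`-linear, left `H`-colinear and right `D`-colinear. -/
@[ext]
structure RelHopfMod.Hom (M N : RelHopfMod k H D) extends
    LeftHopfMod.Hom M.toLeftHopfMod N.toLeftHopfMod where
  rcolinear : N.rcoact ∘ₗ toLinearMap = toLinearMap.rTensor D ∘ₗ M.rcoact

/-- The category `ᴴ_H𝔐ᴰ`. -/
instance : Category (RelHopfMod k H D) where
  Hom M N := RelHopfMod.Hom M N
  id M := ⟨𝟙 M.toLeftHopfMod, by
    change M.rcoact ∘ₗ LinearMap.id = LinearMap.id.rTensor D ∘ₗ M.rcoact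
    simp⟩
  comp {M N P} f g :=
    ⟨CategoryStruct.comp (obj := LeftHopfMod k H) f.toHom g.toHom, by
      change P.rcoact ∘ₗ (g.toLinearMap ∘ₗ f.toLinearMap) =
        (g.toLinearMap ∘ₗ f.toLinearMap).rTensor D ∘ₗ M.rcoact
      rw [← LinearMap.comp_assoc, g.rcolinear, LinearMap.comp_assoc, f.rcolinear,
        LinearMap.rTensor_comp, LinearMap.comp_assoc]⟩

variable (H) in
/-- The right `D`-coaction `h ⊗ w ↦ h₁ ⊗ w₀ ⊗ h₂ w₁` on `H ⊗ W`. -/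
def psiCoact (W : RightComod k D) :
    H ⊗[k] W.carrier →ₗ[k] (H ⊗[k] W.carrier) ⊗[k] D :=
  TensorProduct.lift ((mix W.carrier).compl₁₂ Coalgebra.comul W.coact)

@[simp]
theorem psiCoact_tmul (W : RightComod k D) (h : H) (w : W.carrier) :
    psiCoact H W (h ⊗ₜ w) = mix W.carrier (Coalgebra.comul h) (W.coact w) := rfl

theorem psiCoact_smul (W : RightComod k D) (h : H) (m : H ⊗[k] W.carrier) :
    psiCoact H W (h • m) =
      act₂ k H (H ⊗[k] W.carrier) D (Coalgebra.comul h) (psiCoact H W m) := by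
  induction m with
  | zero => simp
  | add x y hx hy => simp only [smul_add, map_add, hx, hy]
  | tmul a w =>
    simp only [TensorProduct.smul_tmul', smul_eq_mul, psiCoact_tmul, Bialgebra.comul_mul]
    generalize (Coalgebra.comul h : H ⊗[k] H) = s
    generalize (Coalgebra.comul a : H ⊗[k] H) = t
    generalize W.coact w = q
    induction s with
    | zero => simp
    | add x y hx hy => simp only [add_mul, map_add, LinearMap.add_apply, hx, hy]
    | tmul c d =>
      induction t with
      | zero => simp
      | add x y hx hy => simp only [mul_add, map_add, LinearMap.add_apply, hx, hy]
      | tmul e f =>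
        induction q with
        | zero => simp
        | add x y hx hy => simp only [map_add, hx, hy]
        | tmul w' d' => simp [TensorProduct.smul_tmul', mul_smul]

variable [ModuleCoalgebra k H D]

variable (H) in
/-- The object `H ⊗ W` of `ᴴ_H𝔐ᴰ` for a right `D`-comodule `W`. -/
def psiObj (W : RightComod k D) : RelHopfMod k H D where
  toLeftHopfMod := free k H W.carrier
  rcoact := psiCoact H W
  rcoassoc := by
    let F : H ⊗[k] (H ⊗[k] H) →ₗ[k] W.carrier ⊗[k] (D ⊗[k] D) →ₗ[k]
        (H ⊗[k] W.carrier) ⊗[k] (D ⊗[k] D) :=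
      TensorProduct.map₂ (TensorProduct.mk k H W.carrier) (act₂ k H D D)
    have h1 : ∀ (t : H ⊗[k] H) (s : W.carrier ⊗[k] D),
        (TensorProduct.assoc k (H ⊗[k] W.carrier) D D)
          ((psiCoact H W).rTensor D (mix W.carrier t s)) =
        F (TensorProduct.assoc k H H H (Coalgebra.comul.rTensor H t))
          (TensorProduct.assoc k W.carrier D D (W.coact.rTensor D s)) := by
      intro t s
      induction t with
      | zero => simp
      | add x y hx hy => simp only [map_add, LinearMap.add_apply, hx, hy]
      | tmul a b =>
        induction s with
        | zero => simp
        | add x y hx hy => simp only [map_add, hx, hy]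
        | tmul w d =>
          simp only [mix_tmul, LinearMap.rTensor_tmul, psiCoact_tmul]
          generalize (Coalgebra.comul a : H ⊗[k] H) = p
          generalize W.coact w = q
          induction p with
          | zero => simp
          | add x y hx hy => simp only [map_add, LinearMap.add_apply, add_tmul, hx, hy]
          | tmul a' b' =>
            induction q with
            | zero => simp
            | add x y hx hy => simp only [map_add, add_tmul, hx, hy]
            | tmul w' d' => rfl
    have h2 : ∀ (t : H ⊗[k] H) (s : W.carrier ⊗[k] D),
        (Coalgebra.comul.lTensor (H ⊗[k] W.carrier)) (mix W.carrier t s) =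
        F (Coalgebra.comul.lTensor H t) (Coalgebra.comul.lTensor W.carrier s) := by
      intro t s
      induction t with
      | zero => simp
      | add x y hx hy => simp only [map_add, LinearMap.add_apply, hx, hy]
      | tmul a b =>
        induction s with
        | zero => simp
        | add x y hx hy => simp only [map_add, hx, hy]
        | tmul w d =>
          simp only [mix_tmul, LinearMap.lTensor_tmul, ModuleCoalgebra.comul_smul]
          rfl
    have hW : ∀ w, (TensorProduct.assoc k W.carrier D D) (W.coact.rTensor D (W.coact w)) =
        Coalgebra.comul.lTensor W.carrier (W.coact w) := LinearMap.congr_fun W.coassoc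
    change (TensorProduct.assoc k (H ⊗[k] W.carrier) D D).toLinearMap ∘ₗ
      (psiCoact H W).rTensor D ∘ₗ psiCoact H W =
        Coalgebra.comul.lTensor (H ⊗[k] W.carrier) ∘ₗ psiCoact H W
    ext h w
    simp only [AlgebraTensorModule.curry_apply, curry_apply, LinearMap.coe_restrictScalars,
      LinearMap.coe_comp, Function.comp_apply, LinearEquiv.coe_coe, psiCoact_tmul, h1, h2, hW,
      Coalgebra.coassoc_apply]
  counit_rcoact := by
    have h1 : ∀ (t : H ⊗[k] H) (s : W.carrier ⊗[k] D),
        (Coalgebra.counit.lTensor (H ⊗[k] W.carrier)) (mix W.carrier t s) =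
        TensorProduct.map₂ (TensorProduct.mk k H W.carrier) (LinearMap.mul k k)
          (Coalgebra.counit.lTensor H t) (Coalgebra.counit.lTensor W.carrier s) := by
      intro t s
      induction t with
      | zero => simp
      | add x y hx hy => simp only [map_add, LinearMap.add_apply, hx, hy]
      | tmul a b =>
        induction s with
        | zero => simp
        | add x y hx hy => simp only [map_add, hx, hy]
        | tmul w d =>
          simp only [mix_tmul, LinearMap.lTensor_tmul, ModuleCoalgebra.counit_smul (k := k)]
          rfl
    have hW : ∀ w, Coalgebra.counit.lTensor W.carrier (W.coact w) = w ⊗ₜ (1 : k) :=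
      LinearMap.congr_fun W.counit_coact
    change Coalgebra.counit.lTensor (H ⊗[k] W.carrier) ∘ₗ psiCoact H W =
      (TensorProduct.mk k (H ⊗[k] W.carrier) k).flip 1
    ext h w
    simp only [AlgebraTensorModule.curry_apply, curry_apply, LinearMap.coe_restrictScalars,
      LinearMap.coe_comp, Function.comp_apply, psiCoact_tmul, h1, hW,
      Coalgebra.lTensor_counit_comul]
    simp
  bicomodule := by
    let F : H ⊗[k] (H ⊗[k] H) →ₗ[k] W.carrier ⊗[k] D →ₗ[k]
        H ⊗[k] ((H ⊗[k] W.carrier) ⊗[k] D) :=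
      TensorProduct.lift (LinearMap.mk₂ k
        (fun a t => (TensorProduct.mk k H ((H ⊗[k] W.carrier) ⊗[k] D) a) ∘ₗ mix W.carrier t)
        (by intros; ext; simp) (by intros; ext; simp [smul_tmul'])
        (by intros; ext; simp [tmul_add]) (by intros; ext; simp))
    have h1 : ∀ (t : H ⊗[k] H) (s : W.carrier ⊗[k] D),
        (TensorProduct.assoc k H (H ⊗[k] W.carrier) D)
          (((TensorProduct.assoc k H H W.carrier).toLinearMap ∘ₗ
            Coalgebra.comul.rTensor W.carrier).rTensor D (mix W.carrier t s)) =
        F (TensorProduct.assoc k H H H (Coalgebra.comul.rTensor H t)) s := by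
      intro t s
      induction t with
      | zero => simp
      | add x y hx hy => simp only [map_add, LinearMap.add_apply, hx, hy]
      | tmul a b =>
        induction s with
        | zero => simp
        | add x y hx hy => simp only [map_add, hx, hy]
        | tmul w d =>
          simp only [mix_tmul, LinearMap.rTensor_tmul, LinearMap.coe_comp, Function.comp_apply,
            LinearEquiv.coe_coe]
          generalize (Coalgebra.comul a : H ⊗[k] H) = p
          induction p with
          | zero => simp
          | add x y hx hy => simp only [map_add, LinearMap.add_apply, add_tmul, hx, hy]
          | tmul a' b' => rfl
    have h2 : ∀ (t : H ⊗[k] H) (w : W.carrier),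
        (psiCoact H W).lTensor H ((TensorProduct.assoc k H H W.carrier) (t ⊗ₜ w)) =
        F (Coalgebra.comul.lTensor H t) (W.coact w) := by
      intro t w
      induction t with
      | zero => simp
      | add x y hx hy => simp only [map_add, LinearMap.add_apply, add_tmul, hx, hy]
      | tmul a b => rfl
    change (TensorProduct.assoc k H (H ⊗[k] W.carrier) D).toLinearMap ∘ₗ
      ((TensorProduct.assoc k H H W.carrier).toLinearMap ∘ₗ
        Coalgebra.comul.rTensor W.carrier).rTensor D ∘ₗ psiCoact H W =
      (psiCoact H W).lTensor H ∘ₗ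
        ((TensorProduct.assoc k H H W.carrier).toLinearMap ∘ₗ Coalgebra.comul.rTensor W.carrier)
    ext h w
    simp only [AlgebraTensorModule.curry_apply, curry_apply, LinearMap.coe_restrictScalars,
      LinearMap.coe_comp, Function.comp_apply, LinearEquiv.coe_coe, psiCoact_tmul,
      LinearMap.rTensor_tmul, h2]
    rw [← Coalgebra.coassoc_apply, ← h1]
  rcoact_smul h m := psiCoact_smul W h m

variable (k H D)

/-- The functor `Ψ_D : 𝔐ᴰ ⥤ ᴴ_H𝔐ᴰ`, `W ↦ H ⊗ W`. -/
def psi : RightComod k D ⥤ RelHopfMod k H D where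
  obj W := psiObj H W
  map {V W} f :=
    { toHom := (psiVec k H).map (ModuleCat.ofHom f.toLinearMap)
      rcolinear := by
        change psiCoact H W ∘ₗ f.toLinearMap.lTensor H =
          (f.toLinearMap.lTensor H).rTensor D ∘ₗ psiCoact H V
        have hf : ∀ v, W.coact (f.toLinearMap v) = f.toLinearMap.rTensor D (V.coact v) :=
          LinearMap.congr_fun f.colinear
        ext h v
        simp only [AlgebraTensorModule.curry_apply, curry_apply, LinearMap.coe_restrictScalars,
          LinearMap.coe_comp, Function.comp_apply, LinearMap.lTensor_tmul, psiCoact_tmul, hf]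
        generalize (Coalgebra.comul h : H ⊗[k] H) = s
        generalize V.coact v = q
        induction s with
        | zero => simp
        | add x y hx hy => simp only [map_add, LinearMap.add_apply, hx, hy]
        | tmul c d =>
          induction q with
          | zero => simp
          | add x y hx hy => simp only [map_add, hx, hy]
          | tmul w' d' => simp }
  map_id W := by
    apply RelHopfMod.Hom.ext
    exact LinearMap.lTensor_id H W.carrier
  map_comp f g := by
    apply RelHopfMod.Hom.ext
    exact LinearMap.lTensor_comp H g.toLinearMap f.toLinearMap

end HopfModule

section Coinvariants

variable {k : Type v} [Field k] {H : Type u} [Ring H] [Bialgebra k H]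
  {D : Type u} [AddCommGroup D] [Module k D] [Coalgebra k D] [Module H D] [IsScalarTower k H D]

/-- The right coaction maps coinvariants into `M^{co H} ⊗ D`, regarded as a subspace
of `M ⊗ D`. -/
theorem RelHopfMod.rcoact_mem (M : RelHopfMod k H D) (m : M.coinv) :
    M.rcoact m ∈ LinearMap.range (M.coinv.subtype.rTensor D) := by
  let f : M.carrier →ₗ[k] H ⊗[k] M.carrier := M.lcoact - TensorProduct.mk k H M.carrier 1
  have hex : Function.Exact M.coinv.subtype f := LinearMap.exact_subtype_ker_map f
  have := Module.Flat.rTensor_exact D hex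
  refine (this (M.rcoact m)).1 ?_
  have hm : M.lcoact m = 1 ⊗ₜ (m : M.carrier) := (M.mem_coinv m).1 m.2
  have hb := LinearMap.congr_fun M.bicomodule (m : M.carrier)
  simp only [LinearMap.coe_comp, Function.comp_apply, LinearEquiv.coe_coe, hm,
    LinearMap.lTensor_tmul] at hb
  have h1 : ∀ t : M.carrier ⊗[k] D, (TensorProduct.assoc k H M.carrier D)
      ((TensorProduct.mk k H M.carrier 1).rTensor D t) = 1 ⊗ₜ t := by
    intro t
    induction t with
    | zero => simp
    | add x y hx hy => simp only [map_add, tmul_add, hx, hy]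
    | tmul a b => simp
  apply (TensorProduct.assoc k H M.carrier D).injective
  have hs : f.rTensor D (M.rcoact m) + (TensorProduct.mk k H M.carrier 1).rTensor D (M.rcoact m) =
      M.lcoact.rTensor D (M.rcoact m) := by
    have hfm : f + TensorProduct.mk k H M.carrier 1 = M.lcoact :=
      LinearMap.ext fun x => sub_add_cancel (M.lcoact x) (1 ⊗ₜ x)
    rw [← LinearMap.add_apply, ← LinearMap.rTensor_add, hfm]
  have hs' := congrArg (TensorProduct.assoc k H M.carrier D) hs
  rw [map_add, hb, h1] at hs'
  rw [map_zero]
  exact left_eq_add.1 (by rw [add_comm]; exact hs'.symm)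

theorem RelHopfMod.subtype_rTensor_injective (M : RelHopfMod k H D) :
    Function.Injective (M.coinv.subtype.rTensor D) :=
  Module.Flat.rTensor_preserves_injective_linearMap _ M.coinv.injective_subtype

/-- The right `D`-coaction of `M` restricted to the coinvariants. -/
noncomputable def RelHopfMod.coinvCoact (M : RelHopfMod k H D) :
    M.coinv →ₗ[k] M.coinv ⊗[k] D :=
  (LinearEquiv.ofInjective _ M.subtype_rTensor_injective).symm.toLinearMap ∘ₗ
    (M.rcoact ∘ₗ M.coinv.subtype).codRestrict _ M.rcoact_mem

/-- The coaction of `M^{co H}` is the one for which `M^{co H} ⊆ M` is a subcomodule. -/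
theorem RelHopfMod.subtype_coinvCoact (M : RelHopfMod k H D) (m : M.coinv) :
    M.coinv.subtype.rTensor D (M.coinvCoact m) = M.rcoact m := by
  have := LinearEquiv.apply_symm_apply
    (LinearEquiv.ofInjective _ M.subtype_rTensor_injective)
    ((M.rcoact ∘ₗ M.coinv.subtype).codRestrict _ M.rcoact_mem m)
  exact congrArg Subtype.val this

/-- The coinvariants `M^{co H}` as a right `D`-subcomodule of `M`. -/
noncomputable def RelHopfMod.coinvComod (M : RelHopfMod k H D) : RightComod k D where
  carrier := M.coinv
  coact := M.coinvCoact
  coassoc := by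
    ext m
    apply Module.Flat.rTensor_preserves_injective_linearMap (M := D ⊗[k] D)
      M.coinv.subtype M.coinv.injective_subtype
    have h1 : ∀ t : M.coinv ⊗[k] D, (M.coinv.subtype.rTensor (D ⊗[k] D))
        ((TensorProduct.assoc k M.coinv D D) (M.coinvCoact.rTensor D t)) =
        (TensorProduct.assoc k M.carrier D D)
          (M.rcoact.rTensor D (M.coinv.subtype.rTensor D t)) := by
      intro t
      induction t with
      | zero => simp
      | add x y hx hy => simp only [map_add, hx, hy]
      | tmul a b =>
        simp only [LinearMap.rTensor_tmul, Submodule.subtype_apply, ← M.subtype_coinvCoact a]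
        generalize M.coinvCoact a = q
        induction q with
        | zero => simp
        | add x y hx hy => simp only [map_add, add_tmul, hx, hy]
        | tmul c d => simp
    have h2 : ∀ t : M.coinv ⊗[k] D, (M.coinv.subtype.rTensor (D ⊗[k] D))
        (Coalgebra.comul.lTensor M.coinv t) =
        Coalgebra.comul.lTensor M.carrier (M.coinv.subtype.rTensor D t) := by
      intro t
      induction t with
      | zero => simp
      | add x y hx hy => simp only [map_add, hx, hy]
      | tmul a b => simp
    have hM := LinearMap.congr_fun M.rcoassoc (m : M.carrier)
    simp only [LinearMap.coe_comp, Function.comp_apply, LinearEquiv.coe_coe] at hM ⊢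
    rw [h1, h2, M.subtype_coinvCoact, hM]
  counit_coact := by
    ext m
    apply Module.Flat.rTensor_preserves_injective_linearMap (M := k)
      M.coinv.subtype M.coinv.injective_subtype
    have h2 : ∀ t : M.coinv ⊗[k] D, (M.coinv.subtype.rTensor k)
        (Coalgebra.counit.lTensor M.coinv t) =
        Coalgebra.counit.lTensor M.carrier (M.coinv.subtype.rTensor D t) := by
      intro t
      induction t with
      | zero => simp
      | add x y hx hy => simp only [map_add, hx, hy]
      | tmul a b => simp
    have hM := LinearMap.congr_fun M.counit_rcoact (m : M.carrier)
    simp only [LinearMap.coe_comp, Function.comp_apply] at hM ⊢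
    rw [h2, M.subtype_coinvCoact, hM]
    simp

variable (k H D)

/-- The functor of left `H`-coinvariants `ᴴ_H𝔐ᴰ ⥤ 𝔐ᴰ`. -/
noncomputable def coinv : RelHopfMod k H D ⥤ RightComod k D where
  obj M := M.coinvComod
  map {M N} f :=
    { toLinearMap := LeftHopfMod.Hom.restrict f.toHom
      colinear := by
        change N.coinvCoact ∘ₗ LeftHopfMod.Hom.restrict f.toHom =
          (LeftHopfMod.Hom.restrict f.toHom).rTensor D ∘ₗ M.coinvCoact
        ext m
        apply N.subtype_rTensor_injective
        have h1 : ∀ t : M.coinv ⊗[k] D, N.coinv.subtype.rTensor D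
            ((LeftHopfMod.Hom.restrict f.toHom).rTensor D t) =
            f.toLinearMap.rTensor D (M.coinv.subtype.rTensor D t) := by
          intro t
          induction t with
          | zero => simp
          | add x y hx hy => simp only [map_add, hx, hy]
          | tmul a b => rfl
        have hf := LinearMap.congr_fun f.rcolinear (m : M.carrier)
        simp only [LinearMap.coe_comp, Function.comp_apply] at hf ⊢
        rw [h1, N.subtype_coinvCoact, M.subtype_coinvCoact, ← hf]
        rfl }
  map_id _ := rfl
  map_comp _ _ := rfl

end Coinvariants

end HopfMod

/-! Everything is governed by the canonical map `h ⊗ m ↦ h m` from `H ⊗ M^{co H}` to `M`. Over any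
bialgebra the coinvariants of `H ⊗ V` are `1 ⊗ V` (`coinvFree`), so `Ψ` followed by coinvariants is
the identity up to isomorphism. What remains is bijectivity of the canonical map, and this does not
involve `D`: for `M` in `ᴴ_H𝔐ᴰ` the map is automatically `D`-colinear.

Given an antipode `S`, the map `m ↦ S(m₋₁) m₀` is a projection onto the coinvariants, and `m ↦ m₋₁ ⊗
S(m₀₋₁) m₀₀` inverts the canonical map (`LeftHopfMod.canMap_bijective`). Coinvariance of `S(m₋₁) m₀`
comes from a convolution argument (`LeftHopfMod.proj_mem_coinv`), which avoids proving that `S`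
reverses the comultiplication.

For the converse, only essential surjectivity is used, at a single object: `H ⊗ H` with diagonal
action, left coaction `Δ ⊗ id` and, for `Ψ_H`, right coaction `id ⊗ Δ`. If it is isomorphic to some
`H ⊗ V` as a left Hopf module, its canonical map is bijective. That map is the Galois map `β(a ⊗ b)
= a₁ ⊗ a₂ b`, and `S(a) = (ε ⊗ id) β⁻¹(a ⊗ 1)` is an antipode
(`hasAntipode_of_galoisMap_bijective`). -/

namespace HopfMod

/-! ### Coinvariants of free Hopf modules and the canonical map. -/

section LeftHopfModule

variable {k : Type v} [Field k] {H : Type u} [Ring H] [Bialgebra k H]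

/-- Contraction of the first tensor factor by the counit. -/
noncomputable def counitContract (V : Type u) [AddCommGroup V] [Module k V] : H ⊗[k] V →ₗ[k] V :=
  (TensorProduct.lid k V).toLinearMap ∘ₗ Coalgebra.counit.rTensor V

@[simp]
theorem counitContract_tmul (V : Type u) [AddCommGroup V] [Module k V] (h : H) (v : V) :
    counitContract (k := k) V (h ⊗ₜ v) = Coalgebra.counit (R := k) h • v := by
  simp [counitContract]

theorem free_lcoact_tmul (V : Type u) [AddCommGroup V] [Module k V] (h : H) (v : V) :
    (free k H V).lcoact (h ⊗ₜ[k] v : H ⊗[k] V) =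
      TensorProduct.assoc k H H V (Coalgebra.comul h ⊗ₜ v) := rfl

/-- `h₁ ⊗ ε(h₂) v = h ⊗ v`. -/
theorem lTensor_counitContract_lcoact (V : Type u) [AddCommGroup V] [Module k V]
    (x : H ⊗[k] V) : (counitContract V).lTensor H ((free k H V).lcoact x) = x := by
  induction x with
  | zero => exact ((counitContract V).lTensor H ∘ₗ (free k H V).lcoact).map_zero
  | add x y hx hy =>
    exact (((counitContract V).lTensor H ∘ₗ (free k H V).lcoact).map_add x y).trans
      (congrArg₂ (· + ·) hx hy)
  | tmul h v =>
    have key : ∀ t : H ⊗[k] H, (counitContract V).lTensor H (TensorProduct.assoc k H H V (t ⊗ₜ v)) =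
        (TensorProduct.rid k H (Coalgebra.counit.lTensor H t)) ⊗ₜ v := by
      intro t
      induction t with
      | zero => simp
      | add x y hx hy => simp only [map_add, add_tmul, hx, hy]
      | tmul a b => simp [smul_tmul]
    rw [free_lcoact_tmul, key]
    simp

theorem one_tmul_mem_coinv (V : Type u) [AddCommGroup V] [Module k V] (v : V) :
    (1 ⊗ₜ[k] v : H ⊗[k] V) ∈ (free k H V).coinv := by
  refine ((free k H V).mem_coinv _).2 ((free_lcoact_tmul V 1 v).trans ?_)
  rw [Bialgebra.comul_one]
  rfl

/-- The coinvariants of `H ⊗ V` are `1 ⊗ V`. -/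
noncomputable def coinvFree (V : Type u) [AddCommGroup V] [Module k V] :
    V ≃ₗ[k] (free k H V).coinv where
  toFun v := ⟨(1 ⊗ₜ[k] v : H ⊗[k] V), one_tmul_mem_coinv V v⟩
  map_add' x y := Subtype.ext (tmul_add (1 : H) x y)
  map_smul' c x := Subtype.ext (tmul_smul c (1 : H) x)
  invFun x := counitContract V (x.1 : H ⊗[k] V)
  left_inv v := by simp
  right_inv x := by
    -- For coinvariant `x` the coaction is `1 ⊗ x`, so contracting the middle factor turns the
    -- identity into `1 ⊗ (ε ⊗ id)(x) = x`.
    have h1 := lTensor_counitContract_lcoact V (x.1 : H ⊗[k] V)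
    rw [((free k H V).mem_coinv x.1).1 x.2] at h1
    exact Subtype.ext h1

/-- The canonical map `H ⊗ M^{co H} → M`, `h ⊗ m ↦ h m`. -/
def LeftHopfMod.canMap (M : LeftHopfMod k H) : H ⊗[k] M.coinv →ₗ[k] M.carrier :=
  TensorProduct.lift ((act k H M.carrier).compl₂ M.coinv.subtype)

@[simp]
theorem LeftHopfMod.canMap_tmul (M : LeftHopfMod k H) (h : H) (m : M.coinv) :
    M.canMap (h ⊗ₜ m) = h • (m : M.carrier) := rfl

/-- The canonical map `H ⊗ M^{co H} → M` as a morphism of left Hopf modules. -/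
def LeftHopfMod.can (M : LeftHopfMod k H) : LeftHopfMod.Hom (free k H M.coinv) M where
  toLinearMap := M.canMap
  map_smul h x := by
    have key : ∀ y : H ⊗[k] M.coinv, M.canMap (h • y) = h • M.canMap y := by
      intro y
      induction y with
      | zero => simp
      | add x y hx hy => simp only [smul_add, map_add, hx, hy]
      | tmul a m => simp [TensorProduct.smul_tmul', mul_smul]
    exact key x
  lcolinear := by
    change M.lcoact ∘ₗ M.canMap = M.canMap.lTensor H ∘ₗ
      ((TensorProduct.assoc k H H M.coinv).toLinearMap ∘ₗ Coalgebra.comul.rTensor M.coinv)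
    ext h m
    have hm : M.lcoact m = 1 ⊗ₜ (m : M.carrier) := (M.mem_coinv m).1 m.2
    simp only [AlgebraTensorModule.curry_apply, curry_apply, LinearMap.coe_restrictScalars,
      LinearMap.coe_comp, Function.comp_apply, LinearEquiv.coe_coe, LinearMap.rTensor_tmul,
      canMap_tmul, M.lcoact_smul, hm]
    generalize (Coalgebra.comul h : H ⊗[k] H) = s
    induction s with
    | zero => simp
    | add x y hx hy => simp only [map_add, LinearMap.add_apply, add_tmul, hx, hy]
    | tmul a b => simp

/-- The canonical map is natural. -/
theorem LeftHopfMod.Hom.canMap_naturality {M N : LeftHopfMod k H} (f : LeftHopfMod.Hom M N) :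
    N.canMap ∘ₗ f.restrict.lTensor H = f.toLinearMap ∘ₗ M.canMap := by
  ext h m
  exact (f.map_smul h m).symm

/-- The canonical map is bijective for `H ⊗ V`. -/
theorem canMap_free_bijective (V : Type u) [AddCommGroup V] [Module k V] :
    Function.Bijective (free k H V).canMap := by
  -- After identifying `V` with the coinvariants, the canonical map becomes the identity of `H ⊗ V`.
  have h1 : ∀ x : H ⊗[k] V,
      (free k H V).canMap ((coinvFree V).toLinearMap.lTensor H x) = x := by
    intro x
    induction x with
    | zero =>
      exact ((free k H V).canMap ∘ₗ (coinvFree V).toLinearMap.lTensor H).map_zero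
    | add x y hx hy =>
      exact (((free k H V).canMap ∘ₗ (coinvFree V).toLinearMap.lTensor H).map_add x y).trans
        (congrArg₂ (· + ·) hx hy)
    | tmul h v =>
      change h • (1 ⊗ₜ[k] v : H ⊗[k] V) = h ⊗ₜ[k] v
      simp [TensorProduct.smul_tmul']
  refine (Function.Bijective.of_comp_iff _ ((coinvFree V).lTensor H).bijective).1 ?_
  have h2 : (free k H V).canMap ∘ ((coinvFree V).lTensor H) = fun x => x := funext h1
  rw [h2]
  exact Function.bijective_id

/-- A left Hopf module isomorphic to some `H ⊗ V` has a bijective canonical map. -/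
theorem LeftHopfMod.canMap_bijective_of_iso {M : LeftHopfMod k H} (V : Type u) [AddCommGroup V]
    [Module k V] (e : free k H V ≅ M) : Function.Bijective M.canMap := by
  have inv₁ : ∀ {M N : LeftHopfMod k H} (e : M ≅ N) (x : M.carrier),
      LeftHopfMod.Hom.toLinearMap e.inv (LeftHopfMod.Hom.toLinearMap e.hom x) = x := by
    intro M N e x
    exact LinearMap.congr_fun (congrArg LeftHopfMod.Hom.toLinearMap e.hom_inv_id) x
  have bij : Function.Bijective (LeftHopfMod.Hom.toLinearMap e.hom) :=
    Function.bijective_iff_has_inverse.2 ⟨_, inv₁ e, inv₁ e.symm⟩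
  let r : (free k H V).coinv ≃ₗ[k] M.coinv := LinearEquiv.ofLinearMap
    (LeftHopfMod.Hom.restrict e.hom) (LeftHopfMod.Hom.restrict e.inv)
    (LinearMap.ext fun x => Subtype.ext (inv₁ e.symm x))
    (LinearMap.ext fun x => Subtype.ext (inv₁ e x))
  refine (Function.Bijective.of_comp_iff _ (r.lTensor H).bijective).1 ?_
  -- Naturality: the canonical map of `M` preceded by the bijection `id ⊗ r` equals `e.hom` after
  -- the canonical map of `H ⊗ V`, which is bijective.
  have h := congrArg DFunLike.coe (LeftHopfMod.Hom.canMap_naturality e.hom)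
  change M.canMap ∘ (r.lTensor H) = _ at h
  rw [h]
  exact bij.comp (canMap_free_bijective V)

/-- An isomorphism of left Hopf modules from a bijective morphism. -/
noncomputable def LeftHopfMod.Hom.inverse {M N : LeftHopfMod k H} (f : LeftHopfMod.Hom M N)
    (hf : Function.Bijective f.toLinearMap) : LeftHopfMod.Hom N M where
  toLinearMap := (LinearEquiv.ofBijective f.toLinearMap hf).symm.toLinearMap
  map_smul h m := by
    apply hf.1
    have h1 : ∀ y, f.toLinearMap ((LinearEquiv.ofBijective f.toLinearMap hf).symm y) = y :=
      (LinearEquiv.ofBijective f.toLinearMap hf).apply_symm_apply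
    simp only [LinearEquiv.coe_coe, f.map_smul, h1]
  lcolinear := by
    have h1 : f.toLinearMap ∘ₗ (LinearEquiv.ofBijective f.toLinearMap hf).symm.toLinearMap =
      LinearMap.id := LinearMap.ext (LinearEquiv.ofBijective f.toLinearMap hf).apply_symm_apply
    have h2 : (LinearEquiv.ofBijective f.toLinearMap hf).symm.toLinearMap ∘ₗ f.toLinearMap =
      LinearMap.id := LinearMap.ext (LinearEquiv.ofBijective f.toLinearMap hf).symm_apply_apply
    have h3 := congrArg (fun g => (LinearEquiv.ofBijective f.toLinearMap hf).symm.toLinearMap.lTensor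
      H ∘ₗ g ∘ₗ (LinearEquiv.ofBijective f.toLinearMap hf).symm.toLinearMap) f.lcolinear
    simp only [LinearMap.comp_assoc, h1, LinearMap.comp_id] at h3
    rw [h3]
    simp only [← LinearMap.comp_assoc, ← LinearMap.lTensor_comp, h2,
      LinearMap.lTensor_id, LinearMap.id_comp]

end LeftHopfModule

/-! ### Convolution and the fundamental theorem of Hopf modules. -/

section Convolution

variable {k : Type v} [Field k] {H : Type u} [Ring H] [Bialgebra k H]

/-- The convolution `m ↦ A(m₋₁) (f m₀)`. -/
def LeftHopfMod.conv (M : LeftHopfMod k H) {N : Type u} [AddCommGroup N] [Module k N]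
    (A : H →ₗ[k] N →ₗ[k] N) (f : M.carrier →ₗ[k] N) : M.carrier →ₗ[k] N :=
  TensorProduct.lift (A.compl₂ f) ∘ₗ M.lcoact

theorem LeftHopfMod.conv_apply (M : LeftHopfMod k H) {N : Type u} [AddCommGroup N] [Module k N]
    (A : H →ₗ[k] N →ₗ[k] N) (f : M.carrier →ₗ[k] N) (m : M.carrier) :
    M.conv A f m = TensorProduct.lift (A.compl₂ f) (M.lcoact m) := rfl

/-- If `A(h₁) B(h₂) = ε(h)`, then convolution with `A` is left inverse to convolution with `B`. -/
theorem LeftHopfMod.conv_conv (M : LeftHopfMod k H) {N : Type u} [AddCommGroup N] [Module k N]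
    (A B : H →ₗ[k] N →ₗ[k] N) (f : M.carrier →ₗ[k] N)
    (hAB : ∀ h : H, TensorProduct.lift ((LinearMap.mul k (Module.End k N)).compl₁₂ A B)
      (Coalgebra.comul h) = Coalgebra.counit (R := k) h • LinearMap.id) :
    M.conv A (M.conv B f) = f := by
  -- `F(a ⊗ b ⊗ m) = A(a) B(b) f(m)`. Coassociativity replaces the second coaction on `m` by `Δ` on
  -- `m₋₁`, where `hAB` applies; the counit law finishes.
  let F : H ⊗[k] (H ⊗[k] M.carrier) →ₗ[k] N :=
    TensorProduct.lift (A.compl₂ (TensorProduct.lift (B.compl₂ f)))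
  have h1 : ∀ t : H ⊗[k] M.carrier, TensorProduct.lift (A.compl₂ (M.conv B f)) t =
      F (M.lcoact.lTensor H t) := by
    intro t
    induction t with
    | zero => simp
    | add x y hx hy => simp only [map_add, hx, hy]
    | tmul a m => rfl
  have h2 : ∀ t : H ⊗[k] M.carrier,
      F (TensorProduct.assoc k H H M.carrier (Coalgebra.comul.rTensor M.carrier t)) =
      f (TensorProduct.lid k M.carrier (Coalgebra.counit.rTensor M.carrier t)) := by
    intro t
    induction t with
    | zero => simp
    | add x y hx hy => simp only [map_add, hx, hy]
    | tmul a m =>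
      have h3 : ∀ s : H ⊗[k] H, F (TensorProduct.assoc k H H M.carrier (s ⊗ₜ m)) =
          TensorProduct.lift ((LinearMap.mul k (Module.End k N)).compl₁₂ A B) s (f m) := by
        intro s
        induction s with
        | zero => simp
        | add x y hx hy => simp only [map_add, add_tmul, hx, hy, LinearMap.add_apply]
        | tmul b c => rfl
      rw [LinearMap.rTensor_tmul, h3, hAB]
      simp
  ext m
  have h4 := LinearMap.congr_fun M.lcoassoc m
  have h5 := LinearMap.congr_fun M.counit_lcoact m
  simp only [LinearMap.coe_comp, Function.comp_apply, LinearEquiv.coe_coe] at h4 h5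
  rw [M.conv_apply, h1, ← h4, h2, h5]
  simp

/-- With `act₂_one` this makes `M ⊗ N` a module over the algebra `H ⊗ H`; restricting along `Δ`,
which is an algebra map, gives `diagAct`. -/
theorem act₂_mul (M N : Type u) [AddCommGroup M] [Module k M] [Module H M] [IsScalarTower k H M]
    [AddCommGroup N] [Module k N] [Module H N] [IsScalarTower k H N] (s t : H ⊗[k] H) :
    act₂ k H M N (s * t) = act₂ k H M N s ∘ₗ act₂ k H M N t := by
  induction s with
  | zero => simp
  | add x y hx hy => simp only [add_mul, map_add, hx, hy, LinearMap.add_comp]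
  | tmul a b =>
    induction t with
    | zero => simp
    | add x y hx hy => simp only [mul_add, map_add, hx, hy, LinearMap.comp_add]
    | tmul c d =>
      ext m n
      simp [mul_smul]

theorem act₂_one (M N : Type u) [AddCommGroup M] [Module k M] [Module H M] [IsScalarTower k H M]
    [AddCommGroup N] [Module k N] [Module H N] [IsScalarTower k H N] :
    act₂ k H M N 1 = LinearMap.id := by
  ext m n
  simp [Algebra.TensorProduct.one_def]

/-- The diagonal action of `H` on `M ⊗ N`. -/
def diagAct (k : Type v) [Field k] (H : Type u) [Ring H] [Bialgebra k H]
    (M N : Type u) [AddCommGroup M] [Module k M] [Module H M] [IsScalarTower k H M]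
    [AddCommGroup N] [Module k N] [Module H N] [IsScalarTower k H N] :
    H →ₐ[k] Module.End k (M ⊗[k] N) :=
  AlgHom.ofLinearMap (act₂ k H M N ∘ₗ Coalgebra.comul)
    (by rw [LinearMap.comp_apply, Bialgebra.comul_one, act₂_one]; rfl)
    (fun a b => by
      rw [LinearMap.comp_apply, Bialgebra.comul_mul, act₂_mul]; rfl)

variable {S : H →ₗ[k] H}

/-- For an algebra map `A`, `A(S(h₁)) A(h₂) = A(S(h₁) h₂) = ε(h)`. Hence convolution with `A` is
injective and can be cancelled. -/
theorem LeftHopfMod.conv_antipode_conv (M : LeftHopfMod k H)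
    (hS : LinearMap.mul' k H ∘ₗ S.rTensor H ∘ₗ Coalgebra.comul =
      Algebra.linearMap k H ∘ₗ Coalgebra.counit)
    {N : Type u} [AddCommGroup N] [Module k N] (A : H →ₐ[k] Module.End k N)
    (f : M.carrier →ₗ[k] N) :
    M.conv (A.toLinearMap ∘ₗ S) (M.conv A.toLinearMap f) = f := by
  apply M.conv_conv
  intro h
  have h1 : ∀ t : H ⊗[k] H, TensorProduct.lift ((LinearMap.mul k (Module.End k N)).compl₁₂
      (A.toLinearMap ∘ₗ S) A.toLinearMap) t = A (LinearMap.mul' k H (S.rTensor H t)) := by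
    intro t
    induction t with
    | zero => simp
    | add x y hx hy => simp only [map_add, hx, hy]
    | tmul a b => simp
  have h2 := LinearMap.congr_fun hS h
  simp only [LinearMap.coe_comp, Function.comp_apply] at h2
  refine (h1 _).trans ?_
  rw [h2, Algebra.linearMap_apply, AlgHom.commutes, Algebra.algebraMap_eq_smul_one]
  rfl

/-- The mirror image, from `h₁ S(h₂) = ε(h)`; it gives `LeftHopfMod.conv_proj`. -/
theorem LeftHopfMod.conv_conv_antipode (M : LeftHopfMod k H)
    (hS : LinearMap.mul' k H ∘ₗ S.lTensor H ∘ₗ Coalgebra.comul =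
      Algebra.linearMap k H ∘ₗ Coalgebra.counit)
    {N : Type u} [AddCommGroup N] [Module k N] (A : H →ₐ[k] Module.End k N)
    (f : M.carrier →ₗ[k] N) :
    M.conv A.toLinearMap (M.conv (A.toLinearMap ∘ₗ S) f) = f := by
  apply M.conv_conv
  intro h
  have h1 : ∀ t : H ⊗[k] H, TensorProduct.lift ((LinearMap.mul k (Module.End k N)).compl₁₂
      A.toLinearMap (A.toLinearMap ∘ₗ S)) t = A (LinearMap.mul' k H (S.lTensor H t)) := by
    intro t
    induction t with
    | zero => simp
    | add x y hx hy => simp only [map_add, hx, hy]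
    | tmul a b => simp
  have h2 := LinearMap.congr_fun hS h
  simp only [LinearMap.coe_comp, Function.comp_apply] at h2
  refine (h1 _).trans ?_
  rw [h2, Algebra.linearMap_apply, AlgHom.commutes, Algebra.algebraMap_eq_smul_one]
  rfl

/-- The projection `m ↦ S(m₋₁) m₀`. -/
noncomputable def LeftHopfMod.proj (M : LeftHopfMod k H) (S : H →ₗ[k] H) :
    M.carrier →ₗ[k] M.carrier :=
  M.conv ((Algebra.lsmul k k M.carrier).toLinearMap ∘ₗ S) LinearMap.id

/-- `m₋₁ (S(m₀₋₁) m₀₀) = m`. -/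
theorem LeftHopfMod.conv_proj (M : LeftHopfMod k H)
    (hS : LinearMap.mul' k H ∘ₗ S.lTensor H ∘ₗ Coalgebra.comul =
      Algebra.linearMap k H ∘ₗ Coalgebra.counit) :
    M.conv (Algebra.lsmul k k M.carrier).toLinearMap (M.proj S) = LinearMap.id :=
  M.conv_conv_antipode hS (Algebra.lsmul k k M.carrier) LinearMap.id

/-- This is `H`-linearity of the coaction: `Δ(m₋₁) · λ(f(m₀)) = λ(m₋₁ f(m₀))`. -/
theorem LeftHopfMod.lcoact_conv_act (M : LeftHopfMod k H) (f : M.carrier →ₗ[k] M.carrier) :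
    M.conv (diagAct k H H M.carrier).toLinearMap (M.lcoact ∘ₗ f) =
      M.lcoact ∘ₗ M.conv (Algebra.lsmul k k M.carrier).toLinearMap f := by
  have h1 : ∀ t : H ⊗[k] M.carrier,
      TensorProduct.lift ((diagAct k H H M.carrier).toLinearMap.compl₂ (M.lcoact ∘ₗ f)) t =
      M.lcoact (TensorProduct.lift ((Algebra.lsmul k k M.carrier).toLinearMap.compl₂ f) t) := by
    intro t
    induction t with
    | zero => simp
    | add x y hx hy => simp only [map_add, hx, hy]
    | tmul a m => exact (M.lcoact_smul a (f m)).symm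
  ext m
  exact h1 _

/-- By coassociativity, `Δ(m₋₁) · (1 ⊗ f(m₀)) = m₋₁ ⊗ m₀₋₁ f(m₀₀)`. -/
theorem LeftHopfMod.conv_diagAct_mk (M : LeftHopfMod k H) (f : M.carrier →ₗ[k] M.carrier) :
    M.conv (diagAct k H H M.carrier).toLinearMap (TensorProduct.mk k H M.carrier 1 ∘ₗ f) =
      (M.conv (Algebra.lsmul k k M.carrier).toLinearMap f).lTensor H ∘ₗ M.lcoact := by
  let G : H ⊗[k] (H ⊗[k] M.carrier) →ₗ[k] H ⊗[k] M.carrier :=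
    (TensorProduct.lift ((Algebra.lsmul k k M.carrier).toLinearMap.compl₂ f)).lTensor H
  have h1 : ∀ t : H ⊗[k] M.carrier,
      TensorProduct.lift ((diagAct k H H M.carrier).toLinearMap.compl₂
        (TensorProduct.mk k H M.carrier 1 ∘ₗ f)) t =
      G (TensorProduct.assoc k H H M.carrier (Coalgebra.comul.rTensor M.carrier t)) := by
    intro t
    induction t with
    | zero => simp
    | add x y hx hy => simp only [map_add, hx, hy]
    | tmul a m =>
      change act₂ k H H M.carrier (Coalgebra.comul a) (1 ⊗ₜ f m) =
        G (TensorProduct.assoc k H H M.carrier (Coalgebra.comul a ⊗ₜ m))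
      generalize (Coalgebra.comul a : H ⊗[k] H) = s
      induction s with
      | zero => simp
      | add x y hx hy => simp only [map_add, LinearMap.add_apply, add_tmul, hx, hy]
      | tmul b c => simp [G]
  ext m
  have h4 := LinearMap.congr_fun M.lcoassoc m
  simp only [LinearMap.coe_comp, Function.comp_apply, LinearEquiv.coe_coe] at h4
  rw [M.conv_apply, h1, h4, LinearMap.comp_apply, ← LinearMap.comp_apply, ← LinearMap.lTensor_comp]
  rfl

/-- Let `P` be the projection. Convolving either `λ ∘ P` or `1 ⊗ P` with the diagonal action gives
`λ`, because `m₋₁ P(m₀) = m`. Convolution with an algebra map is injective, so `λ ∘ P = 1 ⊗ P`. -/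
theorem LeftHopfMod.proj_mem_coinv (M : LeftHopfMod k H)
    (hS₁ : LinearMap.mul' k H ∘ₗ S.rTensor H ∘ₗ Coalgebra.comul =
      Algebra.linearMap k H ∘ₗ Coalgebra.counit)
    (hS₂ : LinearMap.mul' k H ∘ₗ S.lTensor H ∘ₗ Coalgebra.comul =
      Algebra.linearMap k H ∘ₗ Coalgebra.counit) (m : M.carrier) :
    M.proj S m ∈ M.coinv := by
  have h1 : M.conv (diagAct k H H M.carrier).toLinearMap (M.lcoact ∘ₗ M.proj S) =
      M.conv (diagAct k H H M.carrier).toLinearMap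
        (TensorProduct.mk k H M.carrier 1 ∘ₗ M.proj S) := by
    rw [M.lcoact_conv_act, M.conv_diagAct_mk, M.conv_proj hS₂, LinearMap.lTensor_id,
      LinearMap.id_comp, LinearMap.comp_id]
  have h2 := congrArg (M.conv ((diagAct k H H M.carrier).toLinearMap ∘ₗ S)) h1
  rw [M.conv_antipode_conv hS₁, M.conv_antipode_conv hS₁] at h2
  exact (M.mem_coinv _).2 (LinearMap.congr_fun h2 m)

/-- `S((h m)₋₁) (h m)₀ = ε(h) m` for coinvariant `m`. -/
theorem LeftHopfMod.proj_smul (M : LeftHopfMod k H)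
    (hS : LinearMap.mul' k H ∘ₗ S.rTensor H ∘ₗ Coalgebra.comul =
      Algebra.linearMap k H ∘ₗ Coalgebra.counit) (h : H) (m : M.coinv) :
    M.proj S (h • (m : M.carrier)) = Coalgebra.counit (R := k) h • (m : M.carrier) := by
  have hm : M.lcoact m = 1 ⊗ₜ (m : M.carrier) := (M.mem_coinv m).1 m.2
  -- Since `m` is coinvariant, `λ(h m) = h₁ ⊗ h₂ m`, and the projection sends `h m` to `S(h₁) h₂ m`.
  have h1 : ∀ t : H ⊗[k] H, TensorProduct.lift
      (((Algebra.lsmul k k M.carrier).toLinearMap ∘ₗ S).compl₂ LinearMap.id)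
        (act₂ k H H M.carrier t (1 ⊗ₜ (m : M.carrier))) =
      LinearMap.mul' k H (S.rTensor H t) • (m : M.carrier) := by
    intro t
    induction t with
    | zero => simp
    | add x y hx hy => simp only [map_add, LinearMap.add_apply, add_smul, hx, hy]
    | tmul a b => simp [mul_smul]
  have h2 := LinearMap.congr_fun hS h
  simp only [LinearMap.coe_comp, Function.comp_apply] at h2
  rw [LeftHopfMod.proj, M.conv_apply, M.lcoact_smul, hm, h1, h2, Algebra.linearMap_apply,
    algebraMap_smul]

/-- The fundamental theorem of Hopf modules. -/
theorem LeftHopfMod.canMap_bijective (M : LeftHopfMod k H) (hH : HasAntipode k H) :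
    Function.Bijective M.canMap := by
  obtain ⟨S, hS₁, hS₂⟩ := hH
  let P : M.carrier →ₗ[k] M.coinv := (M.proj S).codRestrict _ (M.proj_mem_coinv hS₁ hS₂)
  refine Function.bijective_iff_has_inverse.2 ⟨P.lTensor H ∘ₗ M.lcoact, ?_, ?_⟩
  -- Colinearity of the canonical map moves the coaction to `H ⊗ M^{co H}`. There `P` after the
  -- canonical map is `ε ⊗ id`, so the counit law returns `x`.
  · have hc : M.lcoact ∘ₗ M.canMap = M.canMap.lTensor H ∘ₗ (free k H M.coinv).lcoact :=
      M.can.lcolinear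
    have hP : P ∘ₗ M.canMap = counitContract M.coinv := by
      ext h m
      exact (M.proj_smul hS₁ h m).trans
        (congrArg Subtype.val (counitContract_tmul (k := k) M.coinv h m)).symm
    intro x
    have h1 := LinearMap.congr_fun hc x
    have h2 := lTensor_counitContract_lcoact M.coinv x
    rw [← hP, LinearMap.lTensor_comp] at h2
    exact (congrArg (P.lTensor H) h1).trans h2
  -- The other composite is `m ↦ m₋₁ P(m₀)`, the identity by `LeftHopfMod.conv_proj`.
  · have h1 : ∀ t : H ⊗[k] M.carrier, M.canMap (P.lTensor H t) =
        TensorProduct.lift ((Algebra.lsmul k k M.carrier).toLinearMap.compl₂ (M.proj S)) t := by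
      intro t
      induction t with
      | zero => simp
      | add x y hx hy => simp only [map_add, hx, hy]
      | tmul a m => rfl
    intro m
    exact (h1 _).trans (LinearMap.congr_fun (M.conv_proj hS₂) m)

end Convolution

/-! ### The Hopf module `H ⊗ H`, the Galois map and the antipode. -/

section Converse

variable (k : Type v) [Field k] (H : Type u) [Ring H] [Bialgebra k H]

/-- The space `H ⊗ H`, to carry the diagonal action of `H`. -/
def DiagTensor : Type u := H ⊗[k] H

noncomputable instance DiagTensor.addCommGroup : AddCommGroup (DiagTensor k H) :=
  inferInstanceAs (AddCommGroup (H ⊗[k] H))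

noncomputable instance DiagTensor.module : Module k (DiagTensor k H) :=
  inferInstanceAs (Module k (H ⊗[k] H))

/-- The type synonym keeps this action apart from the action on the left factor, which `H ⊗[k] H`
already carries. -/
noncomputable instance DiagTensor.moduleDiag : Module H (DiagTensor k H) where
  smul h x := diagAct k H H H h x
  one_smul x := LinearMap.congr_fun (diagAct k H H H).map_one x
  mul_smul a b x := LinearMap.congr_fun ((diagAct k H H H).map_mul a b) x
  smul_zero h := (diagAct k H H H h).map_zero
  smul_add h := (diagAct k H H H h).map_add
  add_smul a b x := LinearMap.congr_fun ((diagAct k H H H).map_add a b) x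
  zero_smul x := LinearMap.congr_fun (diagAct k H H H).map_zero x

instance DiagTensor.isScalarTower : IsScalarTower k H (DiagTensor k H) where
  smul_assoc c h x := LinearMap.congr_fun (map_smul (diagAct k H H H) c h) x

/-- The left Hopf module `H ⊗ H` with the diagonal action and coaction `a ⊗ b ↦ a₁ ⊗ a₂ ⊗ b`. -/
noncomputable def diagHopfMod : LeftHopfMod k H where
  carrier := DiagTensor k H
  addCommGroup := DiagTensor.addCommGroup k H
  module := DiagTensor.module k H
  moduleH := DiagTensor.moduleDiag k H
  isScalarTower := DiagTensor.isScalarTower k H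
  lcoact := (free k H H).lcoact
  lcoassoc := (free k H H).lcoassoc
  counit_lcoact := (free k H H).counit_lcoact
  lcoact_smul h x := by
    -- `A` is the factorwise action of three copies of `H`. Multiplicativity of `Δ` gives `h1`;
    -- coassociativity then turns `(Δ ⊗ id)Δ(h)` into `(id ⊗ Δ)Δ(h)`, whose action is that of `h₁`
    -- on `H` and of `h₂` diagonally on `H ⊗ H`.
    let A : H ⊗[k] (H ⊗[k] H) →ₗ[k] H ⊗[k] (H ⊗[k] H) →ₗ[k] H ⊗[k] (H ⊗[k] H) :=
      TensorProduct.map₂ (act k H H) (act₂ k H H H)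
    have h1 : ∀ s t : H ⊗[k] H, (free k H H).lcoact (act₂ k H H H s t) =
        A (TensorProduct.assoc k H H H (Coalgebra.comul.rTensor H s))
          ((free k H H).lcoact t) := by
      intro s t
      change ((TensorProduct.assoc k H H H).toLinearMap ∘ₗ Coalgebra.comul.rTensor H) _ =
        A _ (((TensorProduct.assoc k H H H).toLinearMap ∘ₗ Coalgebra.comul.rTensor H) t)
      induction s with
      | zero => simp
      | add x y hx hy => simp only [map_add, LinearMap.add_apply, hx, hy]
      | tmul a b =>
        induction t with
        | zero => simp
        | add x y hx hy => simp only [map_add, hx, hy]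
        | tmul c d =>
          simp only [LinearMap.coe_comp, Function.comp_apply, LinearEquiv.coe_coe, act₂_tmul,
            LinearMap.rTensor_tmul, smul_eq_mul, Bialgebra.comul_mul]
          generalize (Coalgebra.comul a : H ⊗[k] H) = p
          generalize (Coalgebra.comul c : H ⊗[k] H) = q
          induction p with
          | zero => simp
          | add x y hx hy =>
            simp only [map_add, LinearMap.add_apply, add_tmul, add_mul, hx, hy]
          | tmul a' b' =>
            induction q with
            | zero => simp
            | add x y hx hy => simp only [map_add, add_tmul, mul_add, hx, hy]
            | tmul c' d' => simp [A]
    have h2 : A ∘ₗ Coalgebra.comul.lTensor H =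
        (act₂ k H H (DiagTensor k H) :
          H ⊗[k] H →ₗ[k] H ⊗[k] (H ⊗[k] H) →ₗ[k] H ⊗[k] (H ⊗[k] H)) :=
      TensorProduct.ext' fun a b => TensorProduct.ext' fun c d => rfl
    have h3 := h1 (Coalgebra.comul h) x
    rw [Coalgebra.coassoc_apply] at h3
    exact h3.trans (LinearMap.congr_fun₂ h2 _ _)

/-- The right coaction `id ⊗ Δ` on `H ⊗ H`. -/
noncomputable def diagRcoact : H ⊗[k] H →ₗ[k] (H ⊗[k] H) ⊗[k] H :=
  (TensorProduct.assoc k H H H).symm.toLinearMap ∘ₗ Coalgebra.comul.lTensor H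

/-- The object `H ⊗ H` of `ᴴ_H𝔐ᴴ` with the diagonal action, left coaction `Δ ⊗ id` and right
coaction `id ⊗ Δ`. -/
noncomputable def diagRelHopfMod : RelHopfMod k H H where
  toLeftHopfMod := diagHopfMod k H
  rcoact := diagRcoact k H
  rcoassoc := by
    change (TensorProduct.assoc k (H ⊗[k] H) H H).toLinearMap ∘ₗ
      ((TensorProduct.assoc k H H H).symm.toLinearMap ∘ₗ Coalgebra.comul.lTensor H).rTensor H ∘ₗ
        ((TensorProduct.assoc k H H H).symm.toLinearMap ∘ₗ Coalgebra.comul.lTensor H) =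
      Coalgebra.comul.lTensor (H ⊗[k] H) ∘ₗ
        ((TensorProduct.assoc k H H H).symm.toLinearMap ∘ₗ Coalgebra.comul.lTensor H)
    ext a b
    have h1 : ∀ t : H ⊗[k] H, (TensorProduct.assoc k (H ⊗[k] H) H H)
        (((TensorProduct.assoc k H H H).symm.toLinearMap ∘ₗ Coalgebra.comul.lTensor H).rTensor H
          ((TensorProduct.assoc k H H H).symm (a ⊗ₜ t))) =
        (TensorProduct.assoc k H H (H ⊗[k] H)).symm
          (a ⊗ₜ TensorProduct.assoc k H H H (Coalgebra.comul.rTensor H t)) := by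
      intro t
      induction t with
      | zero => simp
      | add x y hx hy => simp only [map_add, tmul_add, hx, hy]
      | tmul c d =>
        simp only [TensorProduct.assoc_symm_tmul, LinearMap.rTensor_tmul, LinearMap.coe_comp,
          Function.comp_apply, LinearMap.lTensor_tmul, LinearEquiv.coe_coe]
        generalize (Coalgebra.comul c : H ⊗[k] H) = s
        induction s with
        | zero => simp
        | add x y hx hy => simp only [map_add, tmul_add, add_tmul, hx, hy]
        | tmul e f => simp
    have h2 : ∀ t : H ⊗[k] H, Coalgebra.comul.lTensor (H ⊗[k] H)
          ((TensorProduct.assoc k H H H).symm (a ⊗ₜ t)) =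
        (TensorProduct.assoc k H H (H ⊗[k] H)).symm (a ⊗ₜ Coalgebra.comul.lTensor H t) := by
      intro t
      induction t with
      | zero => simp
      | add x y hx hy => simp only [map_add, tmul_add, hx, hy]
      | tmul c d => simp
    simpa [Coalgebra.coassoc_apply, h2] using h1 (Coalgebra.comul b)
  counit_rcoact := by
    change Coalgebra.counit.lTensor (H ⊗[k] H) ∘ₗ
        ((TensorProduct.assoc k H H H).symm.toLinearMap ∘ₗ Coalgebra.comul.lTensor H) =
      (TensorProduct.mk k (H ⊗[k] H) k).flip 1
    ext a b
    have h2 : ∀ t : H ⊗[k] H, Coalgebra.counit.lTensor (H ⊗[k] H)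
          ((TensorProduct.assoc k H H H).symm (a ⊗ₜ t)) =
        (TensorProduct.assoc k H H k).symm (a ⊗ₜ Coalgebra.counit.lTensor H t) := by
      intro t
      induction t with
      | zero => simp
      | add x y hx hy => simp only [map_add, tmul_add, hx, hy]
      | tmul c d => simp
    simpa using h2 (Coalgebra.comul b)
  bicomodule := by
    change (TensorProduct.assoc k H (H ⊗[k] H) H).toLinearMap ∘ₗ
        ((TensorProduct.assoc k H H H).toLinearMap ∘ₗ Coalgebra.comul.rTensor H).rTensor H ∘ₗ
          ((TensorProduct.assoc k H H H).symm.toLinearMap ∘ₗ Coalgebra.comul.lTensor H) =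
      ((TensorProduct.assoc k H H H).symm.toLinearMap ∘ₗ Coalgebra.comul.lTensor H).lTensor H ∘ₗ
        ((TensorProduct.assoc k H H H).toLinearMap ∘ₗ Coalgebra.comul.rTensor H)
    ext a b
    simp only [AlgebraTensorModule.curry_apply, curry_apply, LinearMap.coe_restrictScalars,
      LinearMap.coe_comp, Function.comp_apply, LinearEquiv.coe_coe, LinearMap.lTensor_tmul,
      LinearMap.rTensor_tmul]
    -- The two coactions touch different factors: up to bracketing, both composites send `a ⊗ b` to
    -- `Δ(a) ⊗ Δ(b)`.
    have h1 : ∀ s t : H ⊗[k] H, (TensorProduct.assoc k H (H ⊗[k] H) H)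
        ((TensorProduct.assoc k H H H).toLinearMap.rTensor H
          ((TensorProduct.assoc k (H ⊗[k] H) H H).symm (s ⊗ₜ t))) =
        (TensorProduct.assoc k H H H).symm.toLinearMap.lTensor H
          (TensorProduct.assoc k H H (H ⊗[k] H) (s ⊗ₜ t)) := by
      intro s t
      induction s with
      | zero => simp
      | add x y hx hy => simp only [map_add, add_tmul, hx, hy]
      | tmul c d =>
        induction t with
        | zero => simp
        | add x y hx hy => simp only [map_add, tmul_add, hx, hy]
        | tmul e f => simp
    have h2 : ∀ t : H ⊗[k] H,
        ((TensorProduct.assoc k H H H).toLinearMap ∘ₗ Coalgebra.comul.rTensor H).rTensor H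
          ((TensorProduct.assoc k H H H).symm (a ⊗ₜ t)) =
        (TensorProduct.assoc k H H H).toLinearMap.rTensor H
          ((TensorProduct.assoc k (H ⊗[k] H) H H).symm (Coalgebra.comul a ⊗ₜ t)) := by
      intro t
      induction t with
      | zero => simp
      | add x y hx hy => simp only [map_add, tmul_add, hx, hy]
      | tmul c d => simp
    have h3 : ∀ s : H ⊗[k] H,
        ((TensorProduct.assoc k H H H).symm.toLinearMap ∘ₗ Coalgebra.comul.lTensor H).lTensor H
          (TensorProduct.assoc k H H H (s ⊗ₜ b)) =
        (TensorProduct.assoc k H H H).symm.toLinearMap.lTensor H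
          (TensorProduct.assoc k H H (H ⊗[k] H) (s ⊗ₜ Coalgebra.comul b)) := by
      intro s
      induction s with
      | zero => simp
      | add x y hx hy => simp only [map_add, add_tmul, hx, hy]
      | tmul c d => simp
    rw [h2, h3, h1]
  rcoact_smul h x := by
    -- As for the left coaction, with coassociativity used in the opposite direction.
    let A : (H ⊗[k] H) ⊗[k] H →ₗ[k] (H ⊗[k] H) ⊗[k] H →ₗ[k] (H ⊗[k] H) ⊗[k] H :=
      TensorProduct.map₂ (act₂ k H H H) (act k H H)
    have h1 : ∀ s t : H ⊗[k] H, diagRcoact k H (act₂ k H H H s t) =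
        A ((TensorProduct.assoc k H H H).symm (Coalgebra.comul.lTensor H s)) (diagRcoact k H t) := by
      intro s t
      induction s with
      | zero => simp
      | add x y hx hy => simp only [map_add, LinearMap.add_apply, hx, hy]
      | tmul a b =>
        induction t with
        | zero => simp
        | add x y hx hy => simp only [map_add, hx, hy]
        | tmul c d =>
          simp only [diagRcoact, LinearMap.coe_comp, Function.comp_apply, LinearEquiv.coe_coe, act₂_tmul,
            LinearMap.lTensor_tmul, smul_eq_mul, Bialgebra.comul_mul]
          generalize (Coalgebra.comul b : H ⊗[k] H) = p
          generalize (Coalgebra.comul d : H ⊗[k] H) = q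
          induction p with
          | zero => simp
          | add x y hx hy =>
            simp only [map_add, LinearMap.add_apply, tmul_add, add_mul, hx, hy]
          | tmul a' b' =>
            induction q with
            | zero => simp
            | add x y hx hy => simp only [map_add, tmul_add, mul_add, hx, hy]
            | tmul c' d' => simp [A]
    have h2 : A ∘ₗ Coalgebra.comul.rTensor H =
        (act₂ k H (DiagTensor k H) H :
          H ⊗[k] H →ₗ[k] (H ⊗[k] H) ⊗[k] H →ₗ[k] (H ⊗[k] H) ⊗[k] H) :=
      TensorProduct.ext' fun a b => TensorProduct.ext' fun c d => rfl
    have h3 := h1 (Coalgebra.comul h) x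
    rw [Coalgebra.coassoc_symm_apply] at h3
    exact h3.trans (LinearMap.congr_fun₂ h2 _ _)

/-- The Galois map `a ⊗ b ↦ a₁ ⊗ a₂ b`. -/
noncomputable def galoisMap : H ⊗[k] H →ₗ[k] H ⊗[k] H :=
  TensorProduct.lift ((act₂ k H H H ∘ₗ Coalgebra.comul).compl₂ (TensorProduct.mk k H H 1))

variable {k H}

theorem galoisMap_tmul (a b : H) :
    galoisMap k H (a ⊗ₜ b) = act₂ k H H H (Coalgebra.comul a) (1 ⊗ₜ b) := rfl

variable (k H) in
/-- The coinvariants of `H ⊗ H` with the diagonal action are `1 ⊗ H`. -/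
noncomputable def coinvDiag : H ≃ₗ[k] (diagHopfMod k H).coinv := coinvFree H

/-- Coinvariants depend only on the coaction, so here too they are `1 ⊗ H`. The diagonal action
sends `a ⊗ (1 ⊗ b)` to `Δ(a) · (1 ⊗ b) = a₁ ⊗ a₂ b`. -/
theorem galoisMap_bijective (h : Function.Bijective (diagHopfMod k H).canMap) :
    Function.Bijective (galoisMap k H) := by
  have h1 : ((diagHopfMod k H).canMap ∘ₗ (coinvDiag k H).toLinearMap.lTensor H :
      H ⊗[k] H →ₗ[k] H ⊗[k] H) = galoisMap k H :=
    TensorProduct.ext' fun a b => rfl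
  have h2 : (diagHopfMod k H).canMap ∘ ((coinvDiag k H).lTensor H) = galoisMap k H :=
    congrArg DFunLike.coe h1
  rw [← h2]
  exact h.comp ((coinvDiag k H).lTensor H).bijective

/-- Both sides send `a ⊗ b` to `a₁ ⊗ a₂ ⊗ a₃ b`. This colinearity passes to `β⁻¹` and determines it
on `a ⊗ 1`. -/
theorem galoisMap_colinear (x : H ⊗[k] H) :
    TensorProduct.assoc k H H H (Coalgebra.comul.rTensor H (galoisMap k H x)) =
      (galoisMap k H).lTensor H (TensorProduct.assoc k H H H (Coalgebra.comul.rTensor H x)) := by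
  induction x with
  | zero => simp
  | add x y hx hy => simp only [map_add, hx, hy]
  | tmul a b =>
    have h1 : ∀ t : H ⊗[k] H, (TensorProduct.assoc k H H H) (Coalgebra.comul.rTensor H
        (act₂ k H H H t (1 ⊗ₜ b))) = ((act₂ k H H H).flip (1 ⊗ₜ b)).lTensor H
          (TensorProduct.assoc k H H H (Coalgebra.comul.rTensor H t)) := by
      intro t
      induction t with
      | zero => simp
      | add x y hx hy => simp only [map_add, LinearMap.add_apply, hx, hy]
      | tmul c d =>
        simp only [act₂_tmul, smul_eq_mul, mul_one, LinearMap.rTensor_tmul]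
        generalize (Coalgebra.comul c : H ⊗[k] H) = s
        induction s with
        | zero => simp
        | add x y hx hy => simp only [map_add, add_tmul, hx, hy]
        | tmul e f => simp
    have h2 : ∀ t : H ⊗[k] H, (galoisMap k H).lTensor H (TensorProduct.assoc k H H H (t ⊗ₜ b)) =
        ((act₂ k H H H).flip (1 ⊗ₜ b)).lTensor H (Coalgebra.comul.lTensor H t) := by
      intro t
      induction t with
      | zero => simp
      | add x y hx hy => simp only [map_add, add_tmul, hx, hy]
      | tmul c d => rfl
    rw [galoisMap_tmul, LinearMap.rTensor_tmul, h1, h2, Coalgebra.coassoc_apply]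

/-- Right `H`-linearity in the second factor: it reduces `β⁻¹(a ⊗ b)` to `β⁻¹(a ⊗ 1)`. -/
theorem galoisMap_mulRight (c : H) (x : H ⊗[k] H) :
    galoisMap k H ((LinearMap.mulRight k c).lTensor H x) =
      (LinearMap.mulRight k c).lTensor H (galoisMap k H x) := by
  induction x with
  | zero => simp
  | add x y hx hy => simp only [map_add, hx, hy]
  | tmul a b =>
    simp only [LinearMap.lTensor_tmul, galoisMap_tmul]
    generalize (Coalgebra.comul a : H ⊗[k] H) = s
    induction s with
    | zero => simp
    | add x y hx hy => simp only [map_add, LinearMap.add_apply, hx, hy]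
    | tmul e f => simp [mul_assoc]

theorem galoisMap_tmul_one (a : H) : galoisMap k H (a ⊗ₜ 1) = Coalgebra.comul a := by
  rw [galoisMap_tmul]
  generalize (Coalgebra.comul a : H ⊗[k] H) = s
  induction s with
  | zero => simp
  | add x y hx hy => simp only [map_add, LinearMap.add_apply, hx, hy]
  | tmul e f => simp

theorem counitContract_galoisMap (x : H ⊗[k] H) :
    counitContract H (galoisMap k H x) = LinearMap.mul' k H x := by
  induction x with
  | zero => simp
  | add x y hx hy => simp only [map_add, hx, hy]
  | tmul a b =>
    have h1 : ∀ s : H ⊗[k] H, counitContract H (act₂ k H H H s (1 ⊗ₜ b)) =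
        TensorProduct.lid k H (Coalgebra.counit.rTensor H s) * b := by
      intro s
      induction s with
      | zero => simp
      | add x y hx hy => simp only [map_add, LinearMap.add_apply, add_mul, hx, hy]
      | tmul e f => simp
    rw [galoisMap_tmul, h1]
    simp

/-- If the Galois map is bijective, then `H` has an antipode. -/
theorem hasAntipode_of_galoisMap_bijective (h : Function.Bijective (galoisMap k H)) :
    HasAntipode k H := by
  let e : (H ⊗[k] H) ≃ₗ[k] (H ⊗[k] H) := LinearEquiv.ofBijective (galoisMap k H) h
  have he : ∀ x, galoisMap k H (e.symm x) = x := e.apply_symm_apply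
  have he' : ∀ x, e.symm (galoisMap k H x) = x := e.symm_apply_apply
  -- With an antipode, `β⁻¹(a ⊗ b)` would be `a₁ ⊗ S(a₂) b`; applying `ε ⊗ id` at `b = 1` recovers
  -- `S(a)`.
  let S : H →ₗ[k] H :=
    counitContract H ∘ₗ e.symm.toLinearMap ∘ₗ (TensorProduct.mk k H H).flip 1
  have hS : ∀ a, S a = counitContract H (e.symm (a ⊗ₜ 1)) := fun _ => rfl
  have hright : ∀ (c : H) (x : H ⊗[k] H), e.symm ((LinearMap.mulRight k c).lTensor H x) =
      (LinearMap.mulRight k c).lTensor H (e.symm x) := by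
    intro c x
    apply h.1
    rw [he, galoisMap_mulRight, he]
  have hcontract : ∀ (c : H) (x : H ⊗[k] H),
      counitContract H ((LinearMap.mulRight k c).lTensor H x) = counitContract H x * c := by
    intro c x
    induction x with
    | zero => simp
    | add x y hx hy => simp only [map_add, add_mul, hx, hy]
    | tmul a b => simp
  -- Right linearity of `β⁻¹` gives `(ε ⊗ id) β⁻¹(a ⊗ b) = S(a) b`.
  have hl : ∀ t : H ⊗[k] H, counitContract H (e.symm t) = LinearMap.mul' k H (S.rTensor H t) := by
    intro t
    induction t with
    | zero => simp
    | add x y hx hy => simp only [map_add, hx, hy]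
    | tmul a b =>
      have h1 := hright b (a ⊗ₜ 1)
      rw [LinearMap.lTensor_tmul, LinearMap.mulRight_apply, one_mul] at h1
      rw [h1, hcontract, ← hS]
      simp
  -- Colinearity of `β⁻¹` gives `β⁻¹(a ⊗ 1) = a₁ ⊗ S(a₂)`, once the middle factor is contracted with
  -- `ε`.
  have hr : ∀ a : H, e.symm (a ⊗ₜ 1) = S.lTensor H (Coalgebra.comul a) := by
    intro a
    have h1 : TensorProduct.assoc k H H H (Coalgebra.comul.rTensor H (e.symm (a ⊗ₜ 1))) =
        e.symm.toLinearMap.lTensor H (TensorProduct.assoc k H H H (Coalgebra.comul a ⊗ₜ 1)) := by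
      apply (e.lTensor H).injective
      have h2 : ∀ y : H ⊗[k] (H ⊗[k] H), e.lTensor H (e.symm.toLinearMap.lTensor H y) = y :=
        (e.lTensor H).apply_symm_apply
      rw [h2]
      refine (galoisMap_colinear _).symm.trans ?_
      rw [he, LinearMap.rTensor_tmul]
    have h2 : (counitContract H).lTensor H (TensorProduct.assoc k H H H
        (Coalgebra.comul.rTensor H (e.symm (a ⊗ₜ 1)))) = e.symm (a ⊗ₜ 1) :=
      lTensor_counitContract_lcoact H (e.symm (a ⊗ₜ[k] (1 : H)))
    rw [h1] at h2
    rw [← h2]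
    generalize (Coalgebra.comul a : H ⊗[k] H) = t
    induction t with
    | zero => simp
    | add x y hx hy => simp only [map_add, add_tmul, hx, hy]
    | tmul c d => rfl
  refine ⟨S, LinearMap.ext fun a => ?_, LinearMap.ext fun a => ?_⟩
  -- Apply `hl` to `Δ(a) = β(a ⊗ 1)`: `S(a₁) a₂ = (ε ⊗ id)(a ⊗ 1)`.
  · change LinearMap.mul' k H (S.rTensor H (Coalgebra.comul a)) = _
    rw [← hl, ← galoisMap_tmul_one, he']
    simp [Algebra.algebraMap_eq_smul_one]
  -- Multiplication is `(ε ⊗ id) ∘ β`, so by `hr`, `a₁ S(a₂) = (ε ⊗ id) β β⁻¹(a ⊗ 1)`.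
  · change LinearMap.mul' k H (S.lTensor H (Coalgebra.comul a)) = _
    rw [← hr, ← counitContract_galoisMap, he]
    simp [Algebra.algebraMap_eq_smul_one]

end Converse

/-! ### The equivalence for vector spaces. -/

section VectorSpaces

variable (k : Type v) [Field k] (H : Type u) [Ring H] [Bialgebra k H]

/-- A bijective morphism of left Hopf modules is an isomorphism. -/
noncomputable def LeftHopfMod.isoOfBijective {k : Type v} [Field k] {H : Type u} [Ring H]
    [Bialgebra k H] {M N : LeftHopfMod k H} (f : M ⟶ N)
    (hf : Function.Bijective (LeftHopfMod.Hom.toLinearMap f)) : M ≅ N where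
  hom := f
  inv := LeftHopfMod.Hom.inverse f hf
  hom_inv_id := LeftHopfMod.Hom.ext (LinearMap.ext
    (LinearEquiv.ofBijective (LeftHopfMod.Hom.toLinearMap f) hf).symm_apply_apply)
  inv_hom_id := LeftHopfMod.Hom.ext (LinearMap.ext
    (LinearEquiv.ofBijective (LeftHopfMod.Hom.toLinearMap f) hf).apply_symm_apply)

/-- The isomorphism `V ≅ (H ⊗ V)^{co H}`. -/
noncomputable def unitVec : 𝟭 (ModuleCat.{u} k) ≅ psiVec k H ⋙ coinvVec k H :=
  NatIso.ofComponents (fun V => (coinvFree V).toModuleIso) fun _ => rfl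

/-- The isomorphism `H ⊗ M^{co H} ≅ M`. -/
noncomputable def counitVec (hH : HasAntipode k H) :
    coinvVec k H ⋙ psiVec k H ≅ 𝟭 (LeftHopfMod k H) :=
  NatIso.ofComponents (fun M => LeftHopfMod.isoOfBijective M.can (M.canMap_bijective hH))
    fun f => LeftHopfMod.Hom.ext (LeftHopfMod.Hom.canMap_naturality f)

/-- The equivalence between vector spaces and left Hopf modules over a Hopf algebra. -/
noncomputable def equivVec (hH : HasAntipode k H) : ModuleCat.{u} k ≌ LeftHopfMod k H :=
  CategoryTheory.Equivalence.mk (psiVec k H) (coinvVec k H) (unitVec k H) (counitVec k H hH)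

end VectorSpaces

/-! ### The equivalence for `D`-comodules. -/

section Comodules

/-- A linear equivalence that is colinear is an isomorphism of comodules. -/
def RightComod.isoOfLinearEquiv {k : Type v} [Field k] {D : Type u} [AddCommGroup D] [Module k D]
    [Coalgebra k D] {V W : RightComod k D} (e : V.carrier ≃ₗ[k] W.carrier)
    (he : W.coact ∘ₗ e.toLinearMap = e.toLinearMap.rTensor D ∘ₗ V.coact) : V ≅ W where
  hom := ⟨e.toLinearMap, he⟩
  inv := ⟨e.symm.toLinearMap, by
    ext x
    apply (e.rTensor D).injective
    have h1 : ∀ y, e.rTensor D (e.symm.toLinearMap.rTensor D y) = y :=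
      (e.rTensor D).apply_symm_apply
    have h2 := LinearMap.congr_fun he (e.symm x)
    simp only [LinearMap.comp_apply, LinearEquiv.coe_coe, LinearEquiv.apply_symm_apply] at h2
    rw [LinearMap.comp_apply, LinearMap.comp_apply, h1, h2]
    rfl⟩
  hom_inv_id := RightComod.Hom.ext (LinearMap.ext e.symm_apply_apply)
  inv_hom_id := RightComod.Hom.ext (LinearMap.ext e.apply_symm_apply)

variable {k : Type v} [Field k] {H : Type u} [Ring H] [Bialgebra k H]
  {D : Type u} [AddCommGroup D] [Module k D] [Coalgebra k D] [Module H D] [IsScalarTower k H D]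

/-- A bijective morphism in `ᴴ_H𝔐ᴰ` is an isomorphism. -/
noncomputable def RelHopfMod.isoOfBijective {M N : RelHopfMod k H D} (f : RelHopfMod.Hom M N)
    (hf : Function.Bijective f.toLinearMap) : M ≅ N where
  hom := f
  inv :=
    { toHom := f.toHom.inverse hf
      rcolinear := by
        let e := LinearEquiv.ofBijective f.toLinearMap hf
        change M.rcoact ∘ₗ e.symm.toLinearMap = e.symm.toLinearMap.rTensor D ∘ₗ N.rcoact
        ext x
        apply (e.rTensor D).injective
        have h1 : ∀ y, e.rTensor D (e.symm.toLinearMap.rTensor D y) = y :=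
          (e.rTensor D).apply_symm_apply
        have h2 : N.rcoact (e (e.symm x)) = e.rTensor D (M.rcoact (e.symm x)) :=
          LinearMap.congr_fun f.rcolinear (e.symm x)
        rw [e.apply_symm_apply] at h2
        rw [LinearMap.comp_apply, LinearMap.comp_apply, h1, h2]
        rfl }
  hom_inv_id := RelHopfMod.Hom.ext (LinearMap.ext
    (LinearEquiv.ofBijective f.toLinearMap hf).symm_apply_apply)
  inv_hom_id := RelHopfMod.Hom.ext (LinearMap.ext
    (LinearEquiv.ofBijective f.toLinearMap hf).apply_symm_apply)

/-- The functor from `ᴴ_H𝔐ᴰ` to left Hopf modules that forgets the right coaction. -/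
def forgetRight : RelHopfMod k H D ⥤ LeftHopfMod k H where
  obj M := M.toLeftHopfMod
  map f := RelHopfMod.Hom.toHom f
  map_id _ := rfl
  map_comp _ _ := rfl

variable [ModuleCoalgebra k H D]

/-- The canonical map `H ⊗ M^{co H} → M` as a morphism in `ᴴ_H𝔐ᴰ`. -/
noncomputable def RelHopfMod.can (M : RelHopfMod k H D) :
    RelHopfMod.Hom (psiObj H M.coinvComod) M where
  toHom := M.toLeftHopfMod.can
  rcolinear := by
    change M.rcoact ∘ₗ M.canMap = M.canMap.rTensor D ∘ₗ psiCoact H M.coinvComod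
    refine TensorProduct.ext' fun h m => ?_
    -- For coinvariant `m` the factor `m₀` of `ρ(m)` may be taken in `M^{co H}`, so both sides
    -- become `h₁ m₀ ⊗ h₂ m₁`.
    have h1 : ∀ (s : H ⊗[k] H) (t : M.coinv ⊗[k] D),
        M.canMap.rTensor D (mix M.coinv s t) =
          act₂ k H M.carrier D s (M.coinv.subtype.rTensor D t) := by
      intro s t
      induction s with
      | zero => simp
      | add x y hx hy => simp only [map_add, LinearMap.add_apply, hx, hy]
      | tmul a b =>
        induction t with
        | zero => simp
        | add x y hx hy => simp only [map_add, hx, hy]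
        | tmul w d => simp
    refine (M.rcoact_smul h m).trans ?_
    rw [← M.subtype_coinvCoact]
    exact (h1 (Coalgebra.comul h) (M.coinvCoact m)).symm

/-- As `Δ(1) = 1 ⊗ 1`, the coaction sends `1 ⊗ w` to `1 ⊗ w₀ ⊗ w₁`. The comparison takes place in
`(H ⊗ W) ⊗ D`, into which `(H ⊗ W)^{co H} ⊗ D` embeds. -/
theorem coinvFree_colinear (W : RightComod k D) :
    (psiObj H W).coinvCoact ∘ₗ (coinvFree (k := k) (H := H) W.carrier).toLinearMap =
      (coinvFree W.carrier).toLinearMap.rTensor D ∘ₗ W.coact := by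
  ext w
  apply (psiObj H W).subtype_rTensor_injective
  have h1 : (psiObj H W).coinv.subtype.rTensor D ∘ₗ
      (coinvFree (k := k) (H := H) W.carrier).toLinearMap.rTensor D =
      mix W.carrier (1 ⊗ₜ[k] (1 : H)) := by
    refine TensorProduct.ext' fun w d => ?_
    exact congrArg (fun d : D => ((1 : H) ⊗ₜ[k] w) ⊗ₜ[k] d) (one_smul H d).symm
  refine ((psiObj H W).subtype_coinvCoact _).trans (Eq.trans ?_ (LinearMap.congr_fun h1 (W.coact w)).symm)
  change mix W.carrier (Coalgebra.comul (1 : H)) (W.coact w) = _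
  rw [Bialgebra.comul_one]
  rfl

variable (k H D)

/-- The isomorphism `W ≅ (H ⊗ W)^{co H}` of right `D`-comodules. -/
noncomputable def unitComod : 𝟭 (RightComod k D) ≅ psi k H D ⋙ coinv k H D :=
  NatIso.ofComponents
    (fun W => RightComod.isoOfLinearEquiv (W := (psiObj H W).coinvComod)
      (coinvFree W.carrier) (coinvFree_colinear W))
    fun _ => rfl

/-- The isomorphism `H ⊗ M^{co H} ≅ M` in `ᴴ_H𝔐ᴰ`. -/
noncomputable def counitComod (hH : HasAntipode k H) :
    coinv k H D ⋙ psi k H D ≅ 𝟭 (RelHopfMod k H D) :=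
  NatIso.ofComponents (fun M => RelHopfMod.isoOfBijective M.can (M.canMap_bijective hH))
    fun f => RelHopfMod.Hom.ext (LeftHopfMod.Hom.canMap_naturality (RelHopfMod.Hom.toHom f))

/-- The equivalence between `𝔐ᴰ` and `ᴴ_H𝔐ᴰ` for a Hopf algebra `H`. -/
noncomputable def equivComod (hH : HasAntipode k H) : RightComod k D ≌ RelHopfMod k H D :=
  CategoryTheory.Equivalence.mk (psi k H D) (coinv k H D) (unitComod k H D) (counitComod k H D hH)

end Comodules

/-! ### From essential surjectivity to the antipode. -/

section Antipode

variable {k : Type v} [Field k] {H : Type u} [Ring H] [Bialgebra k H]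

theorem hasAntipode_of_iso (V : Type u) [AddCommGroup V] [Module k V]
    (e : free k H V ≅ diagHopfMod k H) : HasAntipode k H :=
  hasAntipode_of_galoisMap_bijective
    (galoisMap_bijective (LeftHopfMod.canMap_bijective_of_iso V e))

theorem hasAntipode_of_psiVec_essSurj (h : (psiVec k H).EssSurj) : HasAntipode k H := by
  obtain ⟨V, ⟨e⟩⟩ := h.mem_essImage (diagHopfMod k H)
  exact hasAntipode_of_iso V e

/-- The right coaction serves only to place `H ⊗ H` in `ᴴ_H𝔐ᴴ`; after forgetting it, the argument is
the one for vector spaces. -/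
theorem hasAntipode_of_psi_essSurj (h : (psi k H H).EssSurj) : HasAntipode k H := by
  obtain ⟨W, ⟨e⟩⟩ := h.mem_essImage (diagRelHopfMod k H)
  exact hasAntipode_of_iso W.carrier (forgetRight.mapIso e)

end Antipode

end HopfMod

theorem mainTheorem3 (k : Type v) [Field k] (H : Type u) [Ring H] [Bialgebra k H] :
    List.TFAE
      [HopfMod.HasAntipode k H,
        ∀ (D : Type u) [AddCommGroup D] [Module k D] [Coalgebra k D] [Module H D]
          [IsScalarTower k H D] [HopfMod.ModuleCoalgebra k H D],
          (HopfMod.psi k H D).IsEquivalence,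
        (HopfMod.psiVec k H).IsEquivalence,
        (HopfMod.psi k H H).IsEquivalence] ∧
    (HopfMod.HasAntipode k H →
      (∀ (D : Type u) [AddCommGroup D] [Module k D] [Coalgebra k D] [Module H D]
        [IsScalarTower k H D] [HopfMod.ModuleCoalgebra k H D],
        ∃ e : HopfMod.RightComod k D ≌ HopfMod.RelHopfMod k H D,
          e.functor = HopfMod.psi k H D ∧ e.inverse = HopfMod.coinv k H D) ∧
      ∃ e : ModuleCat.{u} k ≌ HopfMod.LeftHopfMod k H,
        e.functor = HopfMod.psiVec k H ∧ e.inverse = HopfMod.coinvVec k H) := by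
  refine ⟨?_, fun hH => ⟨fun D => ?_, HopfMod.equivVec k H hH, rfl, rfl⟩⟩
  · tfae_have 1 → 2 := fun hH D _ _ _ _ _ _ =>
      (HopfMod.equivComod k H D hH).isEquivalence_functor
    tfae_have 2 → 4 := fun h => h H
    tfae_have 4 → 1 := fun h => HopfMod.hasAntipode_of_psi_essSurj h.essSurj
    tfae_have 1 → 3 := fun hH => (HopfMod.equivVec k H hH).isEquivalence_functor
    tfae_have 3 → 1 := fun h => HopfMod.hasAntipode_of_psiVec_essSurj h.essSurj
    tfae_finish
  · intros
    exact ⟨HopfMod.equivComod k H D hH, rfl, rfl⟩
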